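/- **Setting.** Let $G$ be a finite directed acyclic graph with $n\ge 2$ vertices, let $\rho>1$ be an integer and $0<\gamma<1/2$. Let $H=(V_H,E_H)$ be a subgraph of $G$ in which every vertex has at most $2\rho$ ancestors. For $v\in V_H$, let $A_v$ be the set of ancestors of $v$ in $H$ (including $v$), and for $S\subseteq V_H$ let $A_S=\bigcup_{v\in S}A_v$. Let $E_S$ be the set of edges of $H$ with both endpoints in $A_S$, and $E_v=E_{\{v\}}$. For a set $B$ of vertices, $v$ is *fresh* with respect to $B$ if $|A_v\setminus A_B|>\gamma|A_v|$ and $|E_v\setminus E_B|>\gamma|E_v|$; otherwise it is *stale*. **Estimates.** A run of the estimation procedure on a directed acyclic graph $H'$ draws $r=\lceil\kappa\ln n\rceil$ independent uniformly random hash functions from a strongly 2-universal (pairwise independent) family mapping vertices to $\{1,\dots,n^3\}$, and as many from such a family for edges. For each hash function and each vertex $w$ of $H'$, in topological order, it stores the $t=c/\varepsilon^2$ smallest hash values (with $\varepsilon=1/3$) among the hash value of $w$ and the values stored for the predecessors of $w$ (for edges: among the hash values of the edges entering $w$ and the values stored for the predecessors of $w$). One hash function gives the estimate $t\,n^3/\ell$,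 where $\ell$ is the largest stored value, or the number of stored values if fewer than $t$ are stored; the procedure returns the median over the hash functions. This gives, for every vertex $v$, estimates $a_{H'}(v)$ and $e_{H'}(v)$ of the numbers of ancestors of $v$ in $H'$ and of edges of $H'$ induced by them; both are $0$ if $v$ is not a vertex of $H'$. Every run uses fresh randomness. **FindBatch$(H,\gamma)$.** Let $N=\lceil a\ln n\rceil$, $k=2\lceil\log_2\rho\rceil+2$, and $B=\emptyset$. Run the estimation procedure on $H$ and put the vertices $v$ with $2^i\le e_H(v)<2^{i+1}$ into bucket $K_i$ ($1\le i\le k$); vertices with $e_H(v)<2$ are also put into the smallest bucket $K_1$. While at least one bucket is non-empty, perform the following iteration. 1. (Sampling.) For $i=k,\dots,1$: set $s=0$, and while $s<N$ and $K_i\neq\emptyset$, sample $v$ uniformly from $K_i$ and remove it from $K_i$; if $v$ is fresh with respect to the current $B$, add $v$ to $B$ and set $s=0$; otherwise increase $s$ by $1$. 2. (Pruning.) Run the estimation procedure anew on $H$ and on $H'=H\setminus A_B$, and remove from its bucket every $v$ with $a_{H'}(v)\le 2\gamma\,a_H(v)$ or $e_{H'}(v)\le 2\gamma\,e_H(v)$.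 **Lemma.** With high probability, the outer while loop of FindBatch runs for $O(\ln n)$ iterations before all buckets are empty. Precisely: for every sufficiently large constant $c$, every $d\ge1$, every sufficiently large $\kappa$ (depending on $c,d$) and every $a>0$, there is a constant $C>0$, depending only on $c,d,\kappa,a$, such that for all $G,H,\rho,\gamma$ and hash families as above, with probability at least $1-n^{-d}$ all buckets are empty after at most $C\ln n$ iterations of the outer loop. -/

import Mathlib

/-! ### Directed acyclic graphs, ancestors and ancestor edges -/

/-- A finite directed acyclic graph whose vertices form a subset of the type `V`. -/
structure Dag (V : Type*) where
  verts : Finset V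
  edges : Finset (V × V)
  incident : ∀ e ∈ edges, e.1 ∈ verts ∧ e.2 ∈ verts
  acyclic : ∀ v, ¬ Relation.TransGen (fun a b => (a, b) ∈ edges) v v

namespace Dag

variable {V : Type*}

/-- `H.Adj u v`: there is an edge from `u` to `v`. -/
def Adj (H : Dag V) (u v : V) : Prop := (u, v) ∈ H.edges

theorem adj_wf [Finite V] (H : Dag V) : WellFounded H.Adj := by
  have : Std.Irrefl (Relation.TransGen H.Adj) := ⟨H.acyclic⟩
  have hwf : WellFounded (Relation.TransGen H.Adj) :=
    Finite.wellFounded_of_trans_of_irrefl _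
  exact Subrelation.wf (fun h => Relation.TransGen.single h) hwf

/-- The (immediate) predecessors of `w`. -/
def pred [DecidableEq V] (H : Dag V) (w : V) : Finset V :=
  H.verts.filter fun v => (v, w) ∈ H.edges

open Classical in
/-- The ancestors of `v` in `H`, including `v` itself; this is empty if `v` is not a vertex of
`H`. -/
noncomputable def anc (H : Dag V) (v : V) : Finset V :=
  if v ∈ H.verts then H.verts.filter fun u => Relation.ReflTransGen H.Adj u v else ∅

/-- The ancestors of a set `S` of vertices. -/
noncomputable def ancSet [DecidableEq V] (H : Dag V) (S : Finset V) : Finset V :=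
  S.biUnion H.anc

/-- The edges of the subgraph of `H` induced by the ancestors of the set `S`. -/
noncomputable def ancEdges [DecidableEq V] (H : Dag V) (S : Finset V) : Finset (V × V) :=
  H.edges.filter fun e => e.1 ∈ H.ancSet S ∧ e.2 ∈ H.ancSet S

/-- The graph `H ∖ S`: remove the vertices in `S` and all edges adjacent to them. -/
def remove [DecidableEq V] (H : Dag V) (S : Finset V) : Dag V where
  verts := H.verts \ S
  edges := H.edges.filter fun e => e.1 ∉ S ∧ e.2 ∉ S
  incident := by
    intro e he
    rw [Finset.mem_filter] at he
    have h := H.incident e he.1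
    exact ⟨Finset.mem_sdiff.2 ⟨h.1, he.2.1⟩, Finset.mem_sdiff.2 ⟨h.2, he.2.2⟩⟩
  acyclic := fun v h =>
    H.acyclic v (Relation.TransGen.mono
      (r := fun a b => (a, b) ∈ H.edges.filter fun e => e.1 ∉ S ∧ e.2 ∉ S)
      (fun _ _ hab => (Finset.mem_filter.1 hab).1) v v h)

/-- `H` is a small subgraph for the communication delay `ρ`: every vertex has at most `2ρ`
ancestors. -/
def IsSmall (H : Dag V) (ρ : ℕ) : Prop := ∀ v ∈ H.verts, (H.anc v).card ≤ 2 * ρ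

end Dag

/-! ### The count-distinct estimator -/

/-- A finite family of hash functions `U → [N]`, indexed by seeds, that is (strongly) 2-universal:
for a uniformly random seed, the hash values of any two distinct elements are independent and
uniformly distributed. -/
structure HashFamily (U : Type*) (N : ℕ) where
  Seed : Type
  fintypeSeed : Fintype Seed
  nonemptySeed : Nonempty Seed
  hash : Seed → U → Fin N
  universal : ∀ x y : U, x ≠ y → ∀ i j : Fin N,
    Nat.card {s : Seed // hash s x = i ∧ hash s y = j} * N ^ 2 = Nat.card Seed

attribute [instance] HashFamily.fintypeSeed HashFamily.nonemptySeed

/-- The `t` smallest elements of `T` (all of `T` if it has at most `t` elements). -/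
def smallest (t : ℕ) (T : Finset ℕ) : Finset ℕ :=
  T.filter fun x => (T.filter fun y => y < x).card < t

/-- The sketch of each vertex `w` for one hash function, computed in topological order: insert the
hash values `own w`, merge with the sketches of all predecessors of `w`, and keep the `t` smallest
values. -/
def sketch {V : Type*} [Finite V] [DecidableEq V] (H : Dag V) (t : ℕ) (own : V → Finset ℕ)
    (w : V) : Finset ℕ :=
  if w ∈ H.verts then
    smallest t (own w ∪ (H.pred w).attach.biUnion fun v => sketch H t own v.1)
  else ∅
termination_by H.adj_wf.wrap w
decreasing_by exact (Finset.mem_filter.1 v.2).2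

/-- The cardinality estimate read off from the `t` smallest hash values, the hash values being in
`{1, …, N}`: it is `t * N / ℓ`, where `ℓ` is the largest of the `t` stored values, and simply the
number of stored values if fewer than `t` values are stored. -/
noncomputable def sketchEstimate (t N : ℕ) (T : Finset ℕ) : ℝ :=
  if T.card < t then (T.card : ℝ) else (t : ℝ) * (N : ℝ) / ((T.sup id : ℕ) : ℝ)

/-- The median of `r` real numbers. -/
noncomputable def median {r : ℕ} (x : Fin r → ℝ) : ℝ :=
  ((List.ofFn x).insertionSort (· ≤ ·)).getD (r / 2) 0

/-- The parameters of the estimation procedure for graphs with vertices in `V`: the number `t` of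
hash values stored in a sketch, the number `r` of hash functions, and the 2-universal families from
which the hash functions on vertices and on edges are drawn. -/
structure EstimatorParams (V : Type*) where
  t : ℕ
  r : ℕ
  range : ℕ
  vertexHash : HashFamily V range
  edgeHash : HashFamily (V × V) range

namespace EstimatorParams

variable {V : Type*} [Finite V] [DecidableEq V]

/-- The estimated number of ancestors of `v` in `H`, given the seeds of the hash functions. -/
noncomputable def vertexEstimate (P : EstimatorParams V) (H : Dag V)
    (σ : Fin P.r → P.vertexHash.Seed) (v : V) : ℝ :=
  median fun i => sketchEstimate P.t P.range
    (sketch H P.t (fun w => {(P.vertexHash.hash (σ i) w : ℕ) + 1}) v)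

/-- The estimated number of edges induced by the ancestors of `v` in `H`, given the seeds of the
hash functions. -/
noncomputable def edgeEstimate (P : EstimatorParams V) (H : Dag V)
    (τ : Fin P.r → P.edgeHash.Seed) (v : V) : ℝ :=
  median fun i => sketchEstimate P.t P.range
    (sketch H P.t
      (fun w => (H.pred w).image fun u => (P.edgeHash.hash (τ i) (u, w) : ℕ) + 1) v)

/-- One run of the estimation procedure on `H`, with fresh independent uniformly random hash
functions. It returns the estimated numbers of ancestors and of ancestor edges of all vertices. -/
noncomputable def estimate (P : EstimatorParams V) (H : Dag V) : PMF ((V → ℝ) × (V → ℝ)) :=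
  (PMF.uniformOfFintype (Fin P.r → P.vertexHash.Seed)).bind fun σ =>
    (PMF.uniformOfFintype (Fin P.r → P.edgeHash.Seed)).bind fun τ =>
      PMF.pure (P.vertexEstimate H σ, P.edgeEstimate H τ)

end EstimatorParams

/-! ### The procedure `FindBatch` -/

section FindBatch

variable {V : Type*} [DecidableEq V]

/-- The vertex `v` is fresh with respect to the batch `B` (otherwise it is stale). -/
def IsFresh (H : Dag V) (γ : ℝ) (B : Finset V) (v : V) : Prop :=
  γ * ((H.anc v).card : ℝ) < ((H.anc v \ H.ancSet B).card : ℝ) ∧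
    γ * ((H.ancEdges {v}).card : ℝ) < ((H.ancEdges {v} \ H.ancEdges B).card : ℝ)

/-- The buckets `K i` and the current batch `B`. -/
structure BatchState (V : Type*) where
  K : ℕ → Finset V
  B : Finset V

open Classical in
/-- Inner `while` loop, on the bucket `K` with current batch `B` and with `s` consecutive stale
vertices seen so far: as long as `s < N` and `K` is non-empty, sample `v` uniformly from `K` and
remove it from `K`; if `v` is fresh, then add it to `B` and reset `s`, otherwise increase `s`.
The result is the remaining bucket and the new batch. -/
noncomputable def sampleBucket (H : Dag V) (γ : ℝ) (N : ℕ) (K B : Finset V) (s : ℕ) :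
    PMF (Finset V × Finset V) :=
  if h : s < N ∧ K.Nonempty then
    haveI : Nonempty K := h.2.to_subtype
    (PMF.uniformOfFintype K).bind fun v =>
      if IsFresh H γ B v.1 then sampleBucket H γ N (K.erase v.1) (insert v.1 B) 0
      else sampleBucket H γ N (K.erase v.1) B (s + 1)
  else PMF.pure (K, B)
termination_by K.card
decreasing_by all_goals exact Finset.card_erase_lt_of_mem v.2

/-- The `for` loop: process the buckets `K k, …, K 1` in this order. -/
noncomputable def sampleBuckets (H : Dag V) (γ : ℝ) (N : ℕ) :
    ℕ → BatchState V → PMF (BatchState V)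
  | 0, S => PMF.pure S
  | k + 1, S =>
      (sampleBucket H γ N (S.K (k + 1)) S.B 0).bind fun R =>
        sampleBuckets H γ N k ⟨Function.update S.K (k + 1) R.1, R.2⟩

variable [Finite V]

open Classical in
/-- The procedure `Prune`: estimate in `H` and in `H' = H ∖ A_B`, and remove `v` from its bucket
if one of the two ratios of estimates (in `H'` to in `H`) is at most `2γ`. The comparison is
written without division, so that a vertex without ancestor edges (`0 / 0`) is removed. -/
noncomputable def prune (P : EstimatorParams V) (H : Dag V) (γ : ℝ) (S : BatchState V) :
    PMF (BatchState V) :=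
  (P.estimate H).bind fun e =>
    (P.estimate (H.remove (H.ancSet S.B))).bind fun e' =>
      PMF.pure ⟨fun i => (S.K i).filter fun v =>
        ¬ (e'.1 v ≤ 2 * γ * e.1 v ∨ e'.2 v ≤ 2 * γ * e.2 v), S.B⟩

/-- All buckets `K 1, …, K k` are empty. -/
def AllEmpty (k : ℕ) (S : BatchState V) : Prop := ∀ i ∈ Finset.Icc 1 k, S.K i = ∅

open Classical in
/-- The outer `while` loop (sampling, then pruning, while some bucket is non-empty), interrupted
after at most `T` iterations. -/
noncomputable def whileLoop (P : EstimatorParams V) (H : Dag V) (γ : ℝ) (N k : ℕ) :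
    ℕ → BatchState V → PMF (BatchState V)
  | 0, S => PMF.pure S
  | T + 1, S =>
      if AllEmpty k S then PMF.pure S
      else (sampleBuckets H γ N k S).bind fun S₁ =>
        (prune P H γ S₁).bind fun S₂ => whileLoop P H γ N k T S₂

open Classical in
/-- The initial buckets, given the estimated numbers `e` of ancestor edges:
`K i = {v | 2 ^ i ≤ e v < 2 ^ (i + 1)}`, where the smallest bucket `K 1` also receives the
vertices with `e v < 2` (such as those without proper ancestors). -/
noncomputable def initialBuckets (H : Dag V) (e : V → ℝ) (i : ℕ) : Finset V :=
  H.verts.filter fun v => (i = 1 ∨ (2 : ℝ) ^ i ≤ e v) ∧ e v < (2 : ℝ) ^ (i + 1)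

/-- The number `k = O(log ρ)` of buckets. A vertex with at most `2ρ` ancestors has fewer than
`2ρ²` ancestor edges, so that every estimate with relative error at most `1/3` is below
`4ρ² ≤ 2 ^ k`. -/
def numBuckets (ρ : ℕ) : ℕ := 2 * Nat.clog 2 ρ + 2

/-- `FindBatch(H, γ)`, whose outer `while` loop is interrupted after at most `T` iterations: the
distribution of the state at that time. The uninterrupted loop performs at most `T` iterations
exactly if all buckets are empty in this state. -/
noncomputable def findBatch (P : EstimatorParams V) (H : Dag V) (γ : ℝ) (N k T : ℕ) :
    PMF (BatchState V) :=
  (P.estimate H).bind fun e => whileLoop P H γ N k T ⟨initialBuckets H e.2, ∅⟩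

end FindBatch

/-!
A sketch of a vertex holds the `t` smallest hash values of all its ancestors (or of all edges that
they induce), so an estimate only depends on the hash values of the set that is counted. Chebyshev's
inequality for the number of hash values below a threshold and a first moment bound for the
collisions among them show that one hash function gives a relative error of at most `1 / 3` with
probability at least `5 / 8`; by Hoeffding's inequality the median of `r` of them fails with
probability at most `exp (-r / 32)`.

Let `0 < θ ≤ 1`. As long as more than a fraction `1 - θ` of a bucket is left and fresh, each sample
is stale with probability at most `θ`, so it is unlikely, with probability `O(|K| θ ^ N)`, that
sampling stops because of `N` stale samples in a row. Freshness is lost but never regained as `B`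
grows, so at the end of the sampling phase every bucket has at most a fraction `1 - θ` of fresh
vertices. If the estimates are accurate, then pruning removes all stale vertices, and the
iteration has shrunk the total size of the buckets by the factor `1 - θ`. With
`θ = exp (-(d + 5) / a)` the failure probabilities are polynomially small and `O(log n)` iterations
suffice. Since every iteration removes a vertex, there are at most `n` of them, whatever their
outcome, and the union bound costs a factor `n`.
-/

theorem smallest_subset (t : ℕ) (T : Finset ℕ) : smallest t T ⊆ T := Finset.filter_subset _ _

theorem smallest_eq_self_of_card_lt {t : ℕ} {T : Finset ℕ} (h : (smallest t T).card < t) :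
    smallest t T = T := by
  refine (smallest_subset t T).antisymm (Finset.sdiff_eq_empty_iff_subset.1 ?_)
  by_contra hne
  obtain ⟨x, hx, hmin⟩ := (T \ smallest t T).exists_minimal (Finset.nonempty_iff_ne_empty.2 hne)
  obtain ⟨hxT, hx⟩ := Finset.mem_sdiff.1 hx
  have below_subset : (T.filter fun y => y < x) ⊆ smallest t T := by
    intro y hy
    obtain ⟨hyT, hyx⟩ := Finset.mem_filter.1 hy
    by_contra hy
    exact hyx.not_ge (hmin (Finset.mem_sdiff.2 ⟨hyT, hy⟩) hyx.le)
  exact hx (Finset.mem_filter.2 ⟨hxT, (Finset.card_le_card below_subset).trans_lt h⟩)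

theorem mem_smallest_of_subset {t : ℕ} {S T : Finset ℕ} (hST : S ⊆ T) {x : ℕ} (hx : x ∈ S)
    (h : x ∈ smallest t T) : x ∈ smallest t S :=
  Finset.mem_filter.2 ⟨hx, (Finset.card_le_card (Finset.filter_subset_filter _ hST)).trans_lt
    (Finset.mem_filter.1 h).2⟩

theorem smallest_filter_lt_subset (t x : ℕ) (T : Finset ℕ) :
    smallest t (T.filter fun y => y < x) ⊆ smallest t T := by
  intro y hy
  obtain ⟨hy, hcard⟩ := Finset.mem_filter.1 hy
  obtain ⟨hyT, hyx⟩ := Finset.mem_filter.1 hy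
  refine Finset.mem_filter.2 ⟨hyT, lt_of_le_of_lt (Finset.card_le_card fun z hz => ?_) hcard⟩
  obtain ⟨hzT, hzy⟩ := Finset.mem_filter.1 hz
  exact Finset.mem_filter.2 ⟨Finset.mem_filter.2 ⟨hzT, hzy.trans hyx⟩, hzy⟩

theorem smallest_eq_of_subset {t : ℕ} {S T : Finset ℕ} (h1 : smallest t T ⊆ S) (h2 : S ⊆ T) :
    smallest t S = smallest t T := by
  refine Finset.Subset.antisymm (fun x hx => ?_) fun x hx => mem_smallest_of_subset h2 (h1 hx) hx
  obtain ⟨hxS, hcard⟩ := Finset.mem_filter.1 hx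
  refine Finset.mem_filter.2 ⟨h2 hxS, ?_⟩
  by_contra! hle
  have full : t ≤ (smallest t (T.filter fun y => y < x)).card := by
    by_contra! hlt
    rw [smallest_eq_self_of_card_lt hlt] at hlt
    exact hlt.not_ge hle
  refine hcard.not_ge (full.trans (Finset.card_le_card fun y hy => Finset.mem_filter.2 ⟨?_, ?_⟩))
  · exact h1 (smallest_filter_lt_subset t x T hy)
  · exact (Finset.mem_filter.1 (smallest_subset _ _ hy)).2

theorem smallest_union_biUnion_smallest {ι : Type*} (t : ℕ) (A : Finset ℕ) (s : Finset ι)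
    (g : ι → Finset ℕ) :
    smallest t (A ∪ s.biUnion fun i => smallest t (g i)) = smallest t (A ∪ s.biUnion g) := by
  apply smallest_eq_of_subset
  · intro x hx
    rcases Finset.mem_union.1 (smallest_subset _ _ hx) with hxA | hxg
    · exact Finset.mem_union_left _ hxA
    · obtain ⟨i, hi, hxi⟩ := Finset.mem_biUnion.1 hxg
      refine Finset.mem_union_right _ (Finset.mem_biUnion.2 ⟨i, hi, ?_⟩)
      have hsub : g i ⊆ A ∪ s.biUnion g :=
        (Finset.subset_biUnion_of_mem g hi).trans Finset.subset_union_right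
      exact mem_smallest_of_subset hsub hxi hx
  · exact Finset.union_subset_union_right
      (Finset.biUnion_mono fun i _ => smallest_subset t (g i))

namespace Dag

variable {V : Type*}

theorem mem_anc {H : Dag V} {u v : V} :
    u ∈ H.anc v ↔ v ∈ H.verts ∧ u ∈ H.verts ∧ Relation.ReflTransGen H.Adj u v := by
  unfold anc
  split_ifs with h <;> simp [h]

theorem not_adj_self {H : Dag V} {u : V} : ¬ H.Adj u u := fun h =>
  H.acyclic u (Relation.TransGen.single h)

theorem not_adj_symm {H : Dag V} {u v : V} (h : H.Adj u v) : ¬ H.Adj v u := fun h' =>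
  H.acyclic u ((Relation.TransGen.single h).tail h')

theorem two_mul_card_edges_le [Fintype V] (H : Dag V) :
    2 * H.edges.card ≤ Fintype.card V * (Fintype.card V - 1) := by
  classical
  have mem_swap {x y : V} : (x, y) ∈ H.edges.image Prod.swap ↔ H.Adj y x := by simp [Adj]
  have hdisj : Disjoint H.edges (H.edges.image Prod.swap) :=
    Finset.disjoint_left.2 fun _ he he' => H.not_adj_symm he (mem_swap.1 he')
  have hsub : H.edges ∪ H.edges.image Prod.swap ⊆ (Finset.univ : Finset V).offDiag := by
    rintro ⟨x, y⟩ h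
    refine Finset.mem_offDiag.2 ⟨Finset.mem_univ _, Finset.mem_univ _, fun hxy => ?_⟩
    obtain rfl : x = y := hxy
    exact (Finset.mem_union.1 h).elim H.not_adj_self fun h => H.not_adj_self (mem_swap.1 h)
  calc 2 * H.edges.card = (H.edges ∪ H.edges.image Prod.swap).card := by
        rw [Finset.card_union_of_disjoint hdisj,
          Finset.card_image_of_injective _ Prod.swap_injective, two_mul]
    _ ≤ (Finset.univ : Finset V).offDiag.card := Finset.card_le_card hsub
    _ = Fintype.card V * (Fintype.card V - 1) := by
        rw [Finset.offDiag_card, Finset.card_univ, Nat.mul_sub_one]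

variable [DecidableEq V]

theorem anc_eq_union {H : Dag V} {w : V} (hw : w ∈ H.verts) :
    H.anc w = {w} ∪ (H.pred w).biUnion H.anc := by
  ext u
  simp only [Finset.mem_union, Finset.mem_singleton, Finset.mem_biUnion, mem_anc, pred,
    Finset.mem_filter]
  constructor
  · rintro ⟨-, hu, h⟩
    rcases Relation.ReflTransGen.cases_tail h with h | ⟨v, huv, hvw⟩
    · exact Or.inl h.symm
    · have hv := (H.incident _ hvw).1
      exact Or.inr ⟨v, ⟨hv, hvw⟩, hv, hu, huv⟩
  · rintro (rfl | ⟨v, ⟨-, hvw⟩, -, hu, huv⟩)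
    · exact ⟨hw, hw, Relation.ReflTransGen.refl⟩
    · exact ⟨hw, hu, huv.tail hvw⟩

theorem mem_ancSet_of_mem_anc {H : Dag V} {S : Finset V} {u v : V} (hv : v ∈ H.ancSet S)
    (hu : u ∈ H.anc v) : u ∈ H.ancSet S := by
  obtain ⟨w, hw, hvw⟩ := Finset.mem_biUnion.1 hv
  have hvw := mem_anc.1 hvw
  have huv := mem_anc.1 hu
  exact Finset.mem_biUnion.2 ⟨w, hw, mem_anc.2 ⟨hvw.1, huv.2.1, huv.2.2.trans hvw.2.2⟩⟩

theorem ancEdges_eq_biUnion (H : Dag V) (S : Finset V) :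
    H.ancEdges S = (H.ancSet S).biUnion fun w => (H.pred w).image fun u => (u, w) := by
  ext ⟨x, y⟩
  simp only [ancEdges, Finset.mem_filter, Finset.mem_biUnion, Finset.mem_image, Prod.mk.injEq,
    pred]
  constructor
  · rintro ⟨h, -, hy⟩
    exact ⟨y, hy, x, ⟨(H.incident _ h).1, h⟩, rfl, rfl⟩
  · rintro ⟨y, hy, x, ⟨hx, h⟩, rfl, rfl⟩
    have hxy : x ∈ H.anc y := mem_anc.2 ⟨(H.incident _ h).2, hx, Relation.ReflTransGen.single h⟩
    exact ⟨h, mem_ancSet_of_mem_anc hy hxy, hy⟩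

theorem ancSet_singleton (H : Dag V) (v : V) : H.ancSet {v} = H.anc v :=
  Finset.singleton_biUnion

theorem ancSet_mono {H : Dag V} {S T : Finset V} (hST : S ⊆ T) : H.ancSet S ⊆ H.ancSet T :=
  Finset.biUnion_subset_biUnion_of_subset_left _ hST

theorem ancEdges_mono {H : Dag V} {S T : Finset V} (hST : S ⊆ T) : H.ancEdges S ⊆ H.ancEdges T :=
  Finset.monotone_filter_right _ fun _ _ he => ⟨ancSet_mono hST he.1, ancSet_mono hST he.2⟩

theorem anc_remove_subset (H : Dag V) (S : Finset V) (v : V) :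
    (H.remove S).anc v ⊆ H.anc v \ S := by
  intro u hu
  obtain ⟨hv, hu, h⟩ := mem_anc.1 hu
  rw [remove, Finset.mem_sdiff] at hv hu
  refine Finset.mem_sdiff.2 ⟨mem_anc.2 ⟨hv.1, hu.1, ?_⟩, hu.2⟩
  exact Relation.ReflTransGen.mono (fun _ _ hab => (Finset.mem_filter.1 hab).1) _ _ h

theorem ancEdges_remove_subset (H : Dag V) (B : Finset V) (v : V) :
    (H.remove (H.ancSet B)).ancEdges {v} ⊆ H.ancEdges {v} \ H.ancEdges B := by
  intro e he
  simp only [ancEdges, ancSet_singleton, Finset.mem_filter, Finset.mem_sdiff] at he ⊢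
  obtain ⟨he, hfst, hsnd⟩ := he
  have hfst := Finset.mem_sdiff.1 (anc_remove_subset _ _ _ hfst)
  have hsnd := Finset.mem_sdiff.1 (anc_remove_subset _ _ _ hsnd)
  exact ⟨⟨(Finset.mem_filter.1 he).1, hfst.1, hsnd.1⟩, fun h => hfst.2 h.2.1⟩

theorem card_ancEdges_le [Fintype V] (H : Dag V) (S : Finset V) :
    2 * (H.ancEdges S).card ≤ Fintype.card V * (Fintype.card V - 1) :=
  (Nat.mul_le_mul_left 2 (Finset.card_filter_le _ _)).trans H.two_mul_card_edges_le

end Dag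

theorem sketch_eq_smallest {V : Type*} [Finite V] [DecidableEq V] (H : Dag V) (t : ℕ)
    (own : V → Finset ℕ) (w : V) : sketch H t own w = smallest t ((H.anc w).biUnion own) := by
  induction w using H.adj_wf.induction with
  | _ w ih =>
    rw [sketch]
    split_ifs with hw
    · have sketch_pred : ∀ v ∈ (H.pred w).attach,
          sketch H t own v = smallest t ((H.anc v).biUnion own) :=
        fun v _ => ih v (Finset.mem_filter.1 v.2).2
      have biUnion_attach : ((H.pred w).attach.biUnion fun v => (H.anc v).biUnion own) =
          (H.pred w).biUnion fun v => (H.anc v).biUnion own := by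
        ext x
        simp
      rw [Finset.biUnion_congr rfl sketch_pred, smallest_union_biUnion_smallest, biUnion_attach,
        Dag.anc_eq_union hw, Finset.union_biUnion, Finset.singleton_biUnion,
        Finset.biUnion_biUnion]
    · simp [Dag.anc, hw, smallest]

section SketchEstimate

variable {t N : ℕ} {T : Finset ℕ}

theorem sketchEstimate_of_card_lt (h : (smallest t T).card < t) :
    sketchEstimate t N (smallest t T) = T.card := by
  rw [sketchEstimate, if_pos h, smallest_eq_self_of_card_lt h]

theorem exists_sketchEstimate_eq_div (N : ℕ) (ht : 0 < t) (h : t ≤ (smallest t T).card) :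
    ∃ l ∈ T, sketchEstimate t N (smallest t T) = t * N / (l : ℝ) ∧
      t ≤ (T.filter fun y => y ≤ l).card ∧ (T.filter fun y => y < l).card < t := by
  have hne : (smallest t T).Nonempty := Finset.card_pos.1 (ht.trans_le h)
  obtain ⟨l, hl, hsup⟩ := Finset.exists_mem_eq_sup _ hne (id : ℕ → ℕ)
  refine ⟨l, smallest_subset _ _ hl, ?_, ?_, (Finset.mem_filter.1 hl).2⟩
  · rw [sketchEstimate, if_neg h.not_gt, hsup, id]
  · refine h.trans (Finset.card_le_card fun y hy => ?_)
    exact Finset.mem_filter.2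
      ⟨smallest_subset _ _ hy, (Finset.le_sup (f := id) hy).trans_eq hsup⟩

theorem le_card_filter_of_lt_sketchEstimate (ht : 0 < t) (hpos : ∀ y ∈ T, 0 < y) {u : ℝ}
    (hcard : T.card ≤ u) (hu : 0 < u) (h : u < sketchEstimate t N (smallest t T)) :
    t ≤ (T.filter fun y => y ≤ ⌊t * N / u⌋₊).card := by
  rcases lt_or_ge (smallest t T).card t with hlt | hge
  · rw [sketchEstimate_of_card_lt hlt] at h
    exact absurd hcard h.not_ge
  · obtain ⟨l, hl, hest, hle, -⟩ := exists_sketchEstimate_eq_div N ht hge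
    have hl : (0 : ℝ) < l := by exact_mod_cast hpos l hl
    rw [hest, lt_div_comm₀ hu hl] at h
    refine hle.trans (Finset.card_le_card (Finset.monotone_filter_right _ fun y _ hy => ?_))
    exact hy.trans (Nat.le_floor h.le)

theorem card_filter_lt_of_sketchEstimate_lt (ht : 0 < t) (hpos : ∀ y ∈ T, 0 < y) {u : ℝ}
    (hu : 0 < u) (h : sketchEstimate t N (smallest t T) < u) :
    (T.filter fun y => y ≤ ⌊t * N / u⌋₊).card < t := by
  rcases lt_or_ge (smallest t T).card t with hlt | hge
  · rw [smallest_eq_self_of_card_lt hlt] at hlt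
    exact (Finset.card_filter_le _ _).trans_lt hlt
  · obtain ⟨l, hl, hest, -, hlt⟩ := exists_sketchEstimate_eq_div N ht hge
    have hl : (0 : ℝ) < l := by exact_mod_cast hpos l hl
    rw [hest, div_lt_comm₀ hl hu] at h
    refine (Finset.card_le_card (Finset.monotone_filter_right _ fun y _ hy => ?_)).trans_lt hlt
    exact hy.trans_lt ((Nat.floor_lt (by positivity)).2 h)

theorem card_lt_of_sketchEstimate_lt (ht : 0 < t) (hT : T ⊆ Finset.Icc 1 N) {u : ℝ}
    (hu : u ≤ t) (h : sketchEstimate t N (smallest t T) < u) : T.card < u := by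
  rcases lt_or_ge (smallest t T).card t with hlt | hge
  · rwa [sketchEstimate_of_card_lt hlt] at h
  · obtain ⟨l, hl, hest, -⟩ := exists_sketchEstimate_eq_div N ht hge
    obtain ⟨hpos, hle⟩ := Finset.mem_Icc.1 (hT hl)
    have hpos : (0 : ℝ) < l := by exact_mod_cast hpos
    have hle : (l : ℝ) ≤ N := by exact_mod_cast hle
    have : (t : ℝ) ≤ t * N / l := by
      rw [le_div_iff₀ hpos]
      gcongr
    exact absurd (hest ▸ h) (hu.trans this).not_gt

end SketchEstimate

section Median

variable {r : ℕ} {x : Fin r → ℝ}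

theorem median_eq_apply_sort (x : Fin r → ℝ) (h : r / 2 < r) :
    median x = x (Tuple.sort x ⟨r / 2, h⟩) := by
  have hsort : (List.ofFn x).insertionSort (· ≤ ·) = List.ofFn (x ∘ Tuple.sort x) := by
    refine List.Perm.eq_of_pairwise' (List.pairwise_insertionSort _ _) ?_
      ((List.perm_insertionSort _ _).trans ((Tuple.sort x).ofFn_comp_perm x).symm)
    exact (List.sortedLE_ofFn_iff.2 (Tuple.monotone_sort x)).pairwise
  rw [median, hsort, List.getD_eq_getElem _ _ (by simpa using h)]
  simp

theorem median_mem_Icc {lo hi : ℝ}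
    (h : 2 * (Finset.univ.filter fun i => x i ∉ Set.Icc lo hi).card < r) :
    median x ∈ Set.Icc lo hi := by
  have hr : r / 2 < r := by omega
  have hmono : Monotone (x ∘ Tuple.sort x) := Tuple.monotone_sort x
  have card_lt_of_outside : ∀ s : Finset (Fin r),
      (∀ i ∈ s, x (Tuple.sort x i) ∉ Set.Icc lo hi) → 2 * s.card < r := by
    intro s hs
    refine lt_of_le_of_lt (Nat.mul_le_mul_left 2 ?_) h
    refine Finset.card_le_card_of_injOn (Tuple.sort x) (fun i hi => ?_)
      (Tuple.sort x).injective.injOn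
    exact Finset.mem_coe.2 (Finset.mem_filter.2 ⟨Finset.mem_univ _, hs i hi⟩)
  rw [median_eq_apply_sort x hr]
  constructor
  · by_contra hlt
    have := card_lt_of_outside (Finset.Iic ⟨r / 2, hr⟩) fun i hi hmem =>
      hlt (hmem.1.trans (hmono (Finset.mem_Iic.1 hi)))
    simp only [Fin.card_Iic] at this
    omega
  · by_contra hlt
    have := card_lt_of_outside (Finset.Ici ⟨r / 2, hr⟩) fun i hi hmem =>
      hlt ((hmono (Finset.mem_Ici.1 hi)).trans hmem.2)
    simp only [Fin.card_Ici] at this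
    omega

end Median

theorem two_mul_card_le_two_mul_card_image_add {α β : Type*} [DecidableEq β] (s : Finset α)
    (f : α → β) :
    2 * s.card ≤ 2 * (s.image f).card + (s.offDiag.filter fun e => f e.1 = f e.2).card := by
  classical
  induction s using Finset.induction_on with
  | empty => simp
  | insert x s hx ih =>
    rw [Finset.card_insert_of_notMem hx, Finset.image_insert]
    by_cases hfx : f x ∈ s.image f
    · obtain ⟨y, hy, hyx⟩ := Finset.mem_image.1 hfx
      have hne : y ≠ x := by rintro rfl; exact hx hy
      have new_pairs : ({(x, y), (y, x)} : Finset (α × α)) ∪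
          (s.offDiag.filter fun e => f e.1 = f e.2) ⊆
            ((insert x s).offDiag.filter fun e => f e.1 = f e.2) := by
        intro e he
        simp only [Finset.mem_union, Finset.mem_insert, Finset.mem_singleton, Finset.mem_filter,
          Finset.mem_offDiag] at he ⊢
        grind
      have hdisj : Disjoint ({(x, y), (y, x)} : Finset (α × α))
          (s.offDiag.filter fun e => f e.1 = f e.2) := by
        simp [hx]
      have hcard := Finset.card_le_card new_pairs
      rw [Finset.card_union_of_disjoint hdisj, Finset.card_pair (by simp [hne])] at hcard
      rw [Finset.insert_eq_of_mem hfx]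
      omega
    · have hmono : (s.offDiag.filter fun e => f e.1 = f e.2).card ≤
          ((insert x s).offDiag.filter fun e => f e.1 = f e.2).card :=
        Finset.card_le_card (Finset.filter_subset_filter _
          (Finset.offDiag_mono (Finset.subset_insert x s)))
      rw [Finset.card_insert_of_notMem hfx]
      omega

theorem measureReal_uniformOn_univ {Ω : Type*} [Fintype Ω] [MeasurableSpace Ω]
    [MeasurableSingletonClass Ω] (s : Set Ω) :
    (ProbabilityTheory.uniformOn Set.univ).real s = s.ncard / Fintype.card Ω := by
  rw [MeasureTheory.measureReal_def, ProbabilityTheory.uniformOn_univ,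
    MeasureTheory.Measure.count_apply_finite s s.toFinite, Set.ncard_eq_toFinset_card s]
  simp

namespace HashFamily

open MeasureTheory ProbabilityTheory

variable {U : Type*} {N : ℕ} (F : HashFamily U N)

instance : MeasurableSpace F.Seed := ⊤

instance : DiscreteMeasurableSpace F.Seed := ⟨fun _ => trivial⟩

/-- The law of a uniformly random seed, that is, of a random hash function of the family. -/
noncomputable abbrev law : Measure F.Seed := uniformOn Set.univ

theorem range_pos [Nonempty U] (F : HashFamily U N) : 0 < N :=
  Fin.pos (F.hash (Classical.arbitrary F.Seed) (Classical.arbitrary U))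

theorem map_hash_pair {x y : U} (hxy : x ≠ y) :
    F.law.map (fun s => (F.hash s x, F.hash s y)) = uniformOn Set.univ := by
  have : Nonempty U := ⟨x⟩
  have hN : (N : ℝ) ≠ 0 := by exact_mod_cast F.range_pos.ne'
  have hS : (Fintype.card F.Seed : ℝ) ≠ 0 := by exact_mod_cast Fintype.card_ne_zero
  refine Measure.ext_of_measureReal_singleton fun ij => ?_
  have huniv := F.universal x y hxy ij.1 ij.2
  rw [Nat.card_eq_fintype_card (α := F.Seed)] at huniv
  have hpre : (fun s => (F.hash s x, F.hash s y)) ⁻¹' {ij} =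
      {s | F.hash s x = ij.1 ∧ F.hash s y = ij.2} := by
    ext s
    simp [Prod.ext_iff]
  rw [map_measureReal_apply (by fun_prop) (measurableSet_singleton ij), hpre,
    measureReal_uniformOn_univ, measureReal_uniformOn_univ, Set.ncard_singleton,
    Fintype.card_prod, Fintype.card_fin, Nat.cast_mul, div_eq_div_iff hS (by positivity)]
  have : (Set.ncard {s | F.hash s x = ij.1 ∧ F.hash s y = ij.2} : ℝ) * N ^ 2 =
    Fintype.card F.Seed := by exact_mod_cast huniv
  push_cast
  linear_combination this

theorem law_real_pair_mem {x y : U} (hxy : x ≠ y) (S : Set (Fin N × Fin N)) :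
    F.law.real {s | (F.hash s x, F.hash s y) ∈ S} = S.ncard / N ^ 2 := by
  have h := congrArg (fun μ => μ.real S) (F.map_hash_pair hxy)
  simp only [measureReal_uniformOn_univ, Fintype.card_prod, Fintype.card_fin] at h
  rw [map_measureReal_apply (by fun_prop) S.toFinite.measurableSet] at h
  rw [sq, ← Nat.cast_mul]
  exact h

theorem law_real_mem [Nontrivial U] (x : U) (S : Set (Fin N)) :
    F.law.real {s | F.hash s x ∈ S} = S.ncard / N := by
  obtain ⟨y, hy⟩ := exists_ne x
  have hN : (N : ℝ) ≠ 0 := by exact_mod_cast F.range_pos.ne'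
  have h := F.law_real_pair_mem hy.symm (S ×ˢ Set.univ)
  simp only [Set.mem_prod, Set.mem_univ, and_true, Set.ncard_prod, Set.ncard_univ,
    Nat.card_eq_fintype_card, Fintype.card_fin] at h
  rw [h]
  push_cast
  field_simp

theorem indepFun_hash [Nontrivial U] {x y : U} (hxy : x ≠ y) :
    IndepFun (fun s => F.hash s x) (fun s => F.hash s y) F.law := by
  rw [indepFun_iff_measure_inter_preimage_eq_mul]
  intro S T _ _
  rw [← ENNReal.toReal_eq_toReal_iff' (by finiteness) (by finiteness), ENNReal.toReal_mul]
  calc F.law.real {s | (F.hash s x, F.hash s y) ∈ S ×ˢ T}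
      = S.ncard / N * (T.ncard / N) := by
        rw [F.law_real_pair_mem hxy, Set.ncard_prod]
        push_cast
        ring
    _ = F.law.real {s | F.hash s x ∈ S} * F.law.real {s | F.hash s y ∈ T} := by
        rw [F.law_real_mem, F.law_real_mem]

/-- The number of elements of `A` with hash value less than `k`. -/
def countLt (A : Finset U) (k : ℕ) (s : F.Seed) : ℕ :=
  (A.filter fun x => (F.hash s x : ℕ) < k).card

/-- The number of collisions among the hash values less than `k`: of ordered pairs of distinct
elements of `A` with the same hash value less than `k`. -/
def collisionsLt (A : Finset U) (k : ℕ) (s : F.Seed) : ℕ :=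
  (A.offDiag.filter fun e => F.hash s e.1 = F.hash s e.2 ∧ (F.hash s e.1 : ℕ) < k).card

/-- The set of hash values of the elements of `A`, in the range `{1, …, N}` in which they enter
the sketches. -/
def values (A : Finset U) (s : F.Seed) : Finset ℕ := A.image fun x => (F.hash s x : ℕ) + 1

theorem card_values_le (A : Finset U) (s : F.Seed) : (F.values A s).card ≤ A.card :=
  Finset.card_image_le

theorem values_subset_Icc (A : Finset U) (s : F.Seed) : F.values A s ⊆ Finset.Icc 1 N := by
  intro y hy
  obtain ⟨x, -, rfl⟩ := Finset.mem_image.1 hy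
  exact Finset.mem_Icc.2 ⟨Nat.succ_pos _, (F.hash s x).2⟩

theorem values_filter_le (A : Finset U) (k : ℕ) (s : F.Seed) :
    ((F.values A s).filter fun y => y ≤ k) =
      (A.filter fun x => (F.hash s x : ℕ) < k).image fun x => (F.hash s x : ℕ) + 1 :=
  Finset.filter_image ..

theorem card_values_filter_le_le_countLt (A : Finset U) (k : ℕ) (s : F.Seed) :
    ((F.values A s).filter fun y => y ≤ k).card ≤ F.countLt A k s := by
  rw [values_filter_le]
  exact Finset.card_image_le

theorem two_mul_countLt_le (A : Finset U) (k : ℕ) (s : F.Seed) :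
    2 * F.countLt A k s ≤
      2 * ((F.values A s).filter fun y => y ≤ k).card + F.collisionsLt A k s := by
  rw [values_filter_le]
  refine (two_mul_card_le_two_mul_card_image_add _ fun x => (F.hash s x : ℕ) + 1).trans ?_
  refine Nat.add_le_add_left (Finset.card_le_card fun e he => ?_) _
  simp only [Finset.mem_filter, Finset.mem_offDiag, add_left_inj, Fin.val_inj] at he ⊢
  tauto

theorem law_real_hash_lt [Nontrivial U] (x : U) {k : ℕ} (hk : k ≤ N) :
    F.law.real {s | (F.hash s x : ℕ) < k} = k / N := by
  have h := F.law_real_mem x {i | (i : ℕ) < k}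
  rwa [Set.ncard_eq_toFinset_card', Set.toFinset_ofPred, Fin.card_filter_val_lt,
    min_eq_right hk] at h

theorem law_real_hash_eq_lt {x y : U} (hxy : x ≠ y) {k : ℕ} (hk : k ≤ N) :
    F.law.real {s | F.hash s x = F.hash s y ∧ (F.hash s x : ℕ) < k} = k / N ^ 2 := by
  have h := F.law_real_pair_mem hxy {e | e.1 = e.2 ∧ (e.1 : ℕ) < k}
  have hdiag : {e : Fin N × Fin N | e.1 = e.2 ∧ (e.1 : ℕ) < k} =
      (fun i => (i, i)) '' {i : Fin N | (i : ℕ) < k} := by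
    ext ⟨i, j⟩
    simp only [Set.mem_ofPred_eq, Set.mem_image, Prod.mk.injEq]
    grind
  rwa [hdiag, Set.ncard_image_of_injective _ fun _ _ h => congrArg Prod.fst h,
    Set.ncard_eq_toFinset_card', Set.toFinset_ofPred, Fin.card_filter_val_lt, min_eq_right hk,
    ← hdiag] at h

theorem countLt_eq_sum_indicator (A : Finset U) (k : ℕ) (s : F.Seed) :
    (F.countLt A k s : ℝ) = ∑ x ∈ A, {s | (F.hash s x : ℕ) < k}.indicator 1 s := by
  simp only [countLt, Finset.card_filter, Nat.cast_sum, Nat.cast_ite, Nat.cast_one, Nat.cast_zero,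
    Set.indicator_apply, Set.mem_ofPred_eq, Pi.one_apply]

theorem collisionsLt_eq_sum_indicator (A : Finset U) (k : ℕ) (s : F.Seed) :
    (F.collisionsLt A k s : ℝ) = ∑ e ∈ A.offDiag,
      {s | F.hash s e.1 = F.hash s e.2 ∧ (F.hash s e.1 : ℕ) < k}.indicator 1 s := by
  simp only [collisionsLt, Finset.card_filter, Nat.cast_sum, Nat.cast_ite, Nat.cast_one,
    Nat.cast_zero, Set.indicator_apply, Set.mem_ofPred_eq, Pi.one_apply]

theorem integral_countLt [Nontrivial U] (A : Finset U) {k : ℕ} (hk : k ≤ N) :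
    ∫ s, (F.countLt A k s : ℝ) ∂F.law = A.card * k / N := by
  simp only [F.countLt_eq_sum_indicator]
  rw [integral_finsetSum _ fun _ _ => Integrable.of_finite]
  simp only [integral_indicator_one (Set.toFinite _).measurableSet, F.law_real_hash_lt _ hk]
  rw [Finset.sum_const, nsmul_eq_mul, mul_div_assoc]

theorem integral_collisionsLt (A : Finset U) {k : ℕ} (hk : k ≤ N) :
    ∫ s, (F.collisionsLt A k s : ℝ) ∂F.law = A.card * (A.card - 1) * k / N ^ 2 := by
  simp only [F.collisionsLt_eq_sum_indicator]
  rw [integral_finsetSum _ fun _ _ => Integrable.of_finite]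
  simp only [integral_indicator_one (Set.toFinite _).measurableSet]
  rw [Finset.sum_congr rfl fun e he => F.law_real_hash_eq_lt (Finset.mem_offDiag.1 he).2.2 hk,
    Finset.sum_const, nsmul_eq_mul, Finset.offDiag_card, Nat.cast_sub (Nat.le_mul_self _)]
  push_cast
  ring

theorem variance_countLt_le [Nontrivial U] (A : Finset U) {k : ℕ} (hk : k ≤ N) :
    Var[fun s => (F.countLt A k s : ℝ); F.law] ≤ A.card * k / N := by
  have hindep : Set.Pairwise (A : Set U) fun x y =>
      IndepFun ({s | (F.hash s x : ℕ) < k}.indicator (1 : F.Seed → ℝ))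
        ({s | (F.hash s y : ℕ) < k}.indicator 1) F.law := fun x _ y _ hxy =>
    (F.indepFun_hash hxy).comp (φ := {i : Fin N | (i : ℕ) < k}.indicator (1 : Fin N → ℝ))
      (ψ := {i : Fin N | (i : ℕ) < k}.indicator (1 : Fin N → ℝ)) (by fun_prop) (by fun_prop)
  have hvar : ∀ x ∈ A, Var[{s | (F.hash s x : ℕ) < k}.indicator 1; F.law] ≤ k / N := by
    intro x _
    refine (variance_le_expectation_sq (by fun_prop)).trans_eq ?_
    rw [← F.law_real_hash_lt x hk, ← integral_indicator_one (Set.toFinite _).measurableSet]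
    congr 1
    ext s
    simp [Set.indicator_apply]
  have hsum : (fun s => (F.countLt A k s : ℝ)) =
      ∑ x ∈ A, {s | (F.hash s x : ℕ) < k}.indicator 1 := by
    ext s
    rw [F.countLt_eq_sum_indicator, Finset.sum_apply]
  rw [hsum, IndepFun.variance_sum (fun _ _ => MemLp.of_discrete) hindep,
    mul_div_assoc, ← nsmul_eq_mul]
  exact Finset.sum_le_card_nsmul _ _ _ hvar

theorem law_real_le_abs_countLt_sub_le [Nontrivial U] (A : Finset U) {k : ℕ} (hk : k ≤ N) {b : ℝ}
    (hb : 0 < b) : F.law.real {s | b ≤ |(F.countLt A k s : ℝ) - A.card * k / N|} ≤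
      A.card * k / N / b ^ 2 := by
  have h := meas_ge_le_variance_div_sq (μ := F.law) (X := fun s => (F.countLt A k s : ℝ))
    MemLp.of_discrete hb
  rw [F.integral_countLt A hk] at h
  refine (ENNReal.toReal_le_of_le_ofReal
    (div_nonneg (variance_nonneg _ _) (sq_nonneg b)) h).trans ?_
  gcongr
  exact F.variance_countLt_le A hk

theorem law_real_le_collisionsLt_le [Nonempty U] (A : Finset U)
    (hA : 8 * ((A.card : ℝ) - 1) ≤ N) {k : ℕ} (hk : k ≤ N) {b : ℝ} (hb : 0 < b) :
    F.law.real {s | b ≤ F.collisionsLt A k s} ≤ A.card * k / N / (8 * b) := by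
  have hN : (0 : ℝ) < N := by exact_mod_cast F.range_pos
  calc F.law.real {s | b ≤ F.collisionsLt A k s}
      ≤ A.card * (A.card - 1) * k / N ^ 2 / b := by
        rw [le_div_iff₀' hb, ← F.integral_collisionsLt A hk]
        exact mul_meas_ge_le_integral_of_nonneg (ae_of_all _ fun _ => Nat.cast_nonneg _)
          Integrable.of_finite b
    _ = A.card * k / N / (8 * b) * (8 * (A.card - 1) / N) := by field_simp
    _ ≤ A.card * k / N / (8 * b) :=
        mul_le_of_le_one_right (by positivity) ((div_le_one hN).2 hA)

/-- The estimate of the number of elements of `A` that the hash function with seed `s` gives when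
the `t` smallest hash values are stored. -/
noncomputable def cardEstimate (t : ℕ) (A : Finset U) (s : F.Seed) : ℝ :=
  sketchEstimate t N (smallest t (F.values A s))

theorem pos_of_mem_values {A : Finset U} {s : F.Seed} : ∀ y ∈ F.values A s, 0 < y := fun _ hy =>
  (Finset.mem_Icc.1 (F.values_subset_Icc A s hy)).1

theorem le_countLt_of_lt_cardEstimate {A : Finset U} {t : ℕ} (ht : 0 < t) {u : ℝ}
    (hAu : A.card ≤ u) (hu : 0 < u) {s : F.Seed} (hs : u < F.cardEstimate t A s) :
    t ≤ F.countLt A (min ⌊t * N / u⌋₊ N) s := by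
  have hcard : ((F.values A s).card : ℝ) ≤ u := (Nat.cast_le.2 (F.card_values_le A s)).trans hAu
  refine (le_card_filter_of_lt_sketchEstimate ht F.pos_of_mem_values hcard hu hs).trans ?_
  refine le_trans (Finset.card_le_card fun y hy => ?_) (F.card_values_filter_le_le_countLt A _ s)
  obtain ⟨hyv, hy⟩ := Finset.mem_filter.1 hy
  exact Finset.mem_filter.2 ⟨hyv, le_min hy (Finset.mem_Icc.1 (F.values_subset_Icc A s hyv)).2⟩

theorem two_mul_countLt_lt_of_cardEstimate_lt {A : Finset U} {t : ℕ} (ht : 0 < t)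
    {u : ℝ} (hu : 0 < u) {s : F.Seed} (hs : F.cardEstimate t A s < u) :
    2 * F.countLt A ⌊t * N / u⌋₊ s < 2 * t + F.collisionsLt A ⌊t * N / u⌋₊ s := by
  have := card_filter_lt_of_sketchEstimate_lt ht F.pos_of_mem_values hu hs
  have := F.two_mul_countLt_le A ⌊t * N / u⌋₊ s
  omega

theorem law_real_lt_cardEstimate_le [Nontrivial U] {A : Finset U} (hA : A.Nonempty) {t : ℕ}
    (ht : 0 < t) : F.law.real {s | 4 / 3 * A.card < F.cardEstimate t A s} ≤ 12 / t := by
  have hN : (0 : ℝ) < N := by exact_mod_cast F.range_pos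
  have hm : (0 : ℝ) < A.card := by exact_mod_cast hA.card_pos
  have : (0 : ℝ) < t := by exact_mod_cast ht
  set u : ℝ := 4 / 3 * A.card with hu
  have hu0 : 0 < u := by positivity
  set k := min ⌊t * N / u⌋₊ N
  have expectation_le : A.card * k / N ≤ (3 / 4 : ℝ) * t := by
    have hk : (k : ℝ) ≤ t * N / u :=
      (Nat.cast_le.2 (min_le_left _ _)).trans (Nat.floor_le (by positivity))
    calc (A.card * k / N : ℝ) ≤ A.card * (t * N / u) / N := by gcongr
      _ = 3 / 4 * t := by rw [hu]; field_simp
  calc F.law.real {s | u < F.cardEstimate t A s}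
      ≤ F.law.real {s | t / 4 ≤ |(F.countLt A k s : ℝ) - A.card * k / N|} := by
        refine measureReal_mono fun s hs => ?_
        have hle := le_abs_self ((F.countLt A k s : ℝ) - A.card * k / N)
        have : (t : ℝ) ≤ F.countLt A k s :=
          Nat.cast_le.2 (F.le_countLt_of_lt_cardEstimate ht (by linarith) hu0 hs)
        change t / 4 ≤ |(F.countLt A k s : ℝ) - A.card * k / N|
        linarith
    _ ≤ A.card * k / N / (t / 4) ^ 2 :=
        F.law_real_le_abs_countLt_sub_le A (min_le_right _ _) (by positivity)
    _ ≤ 3 / 4 * t / (t / 4) ^ 2 := by gcongr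
    _ = 12 / t := by field_simp; norm_num

theorem countLt_range (A : Finset U) (s : F.Seed) : F.countLt A N s = A.card := by
  rw [countLt, Finset.filter_true_of_mem fun x _ => (F.hash s x).2]

theorem law_real_cardEstimate_lt_le_of_card_le [Nonempty U] {A : Finset U} (hA : A.Nonempty)
    (hAN : 8 * ((A.card : ℝ) - 1) ≤ N) {t : ℕ} (ht : 0 < t) (hAt : 2 / 3 * (A.card : ℝ) ≤ t) :
    F.law.real {s | F.cardEstimate t A s < 2 / 3 * A.card} ≤ 3 / 16 := by
  have hN : (0 : ℝ) < N := by exact_mod_cast F.range_pos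
  have : (0 : ℝ) < A.card := by exact_mod_cast hA.card_pos
  calc F.law.real {s | F.cardEstimate t A s < 2 / 3 * A.card}
      ≤ F.law.real {s | 2 / 3 * (A.card : ℝ) ≤ F.collisionsLt A N s} := by
        refine measureReal_mono fun s hs => ?_
        have hvalues := card_lt_of_sketchEstimate_lt ht (F.values_subset_Icc A s) hAt hs
        have hfilter : ((F.values A s).filter fun y => y ≤ N).card ≤ (F.values A s).card :=
          Finset.card_filter_le _ _
        have hcount := F.two_mul_countLt_le A N s
        rw [countLt_range] at hcount
        have : 2 * (A.card : ℝ) ≤ 2 * (F.values A s).card + F.collisionsLt A N s := by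
          exact_mod_cast hcount.trans (by omega)
        change 2 / 3 * (A.card : ℝ) ≤ F.collisionsLt A N s
        linarith
    _ ≤ A.card * N / N / (8 * (2 / 3 * A.card)) :=
        F.law_real_le_collisionsLt_le A hAN le_rfl (by positivity)
    _ = 3 / 16 := by field_simp; norm_num

theorem law_real_cardEstimate_lt_le_add [Nontrivial U] {A : Finset U}
    (hAN : 8 * ((A.card : ℝ) - 1) ≤ N) {t k : ℕ} (ht : 0 < t) {u b c : ℝ} (hu : 0 < u)
    (hk : k = ⌊t * N / u⌋₊) (hkN : k ≤ N) (hb : 0 < b) (hc : 0 < c)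
    (hbc : t + c / 2 + b ≤ A.card * k / N) :
    F.law.real {s | F.cardEstimate t A s < u} ≤
      A.card * k / N / b ^ 2 + A.card * k / N / (8 * c) := by
  have bad_subset : {s | F.cardEstimate t A s < u} ⊆
      {s | b ≤ |(F.countLt A k s : ℝ) - A.card * k / N|} ∪
        {s | c ≤ (F.collisionsLt A k s : ℝ)} := by
    intro s hs
    have hcount := F.two_mul_countLt_lt_of_cardEstimate_lt ht hu hs
    rw [← hk] at hcount
    have : 2 * (F.countLt A k s : ℝ) < 2 * t + F.collisionsLt A k s := by exact_mod_cast hcount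
    by_contra! h
    obtain ⟨hdev, hcoll⟩ := not_or.1 h
    rw [Set.mem_ofPred_eq, not_le] at hdev hcoll
    linarith [neg_le_abs ((F.countLt A k s : ℝ) - A.card * k / N)]
  exact (measureReal_mono bad_subset).trans ((measureReal_union_le _ _).trans (add_le_add
    (F.law_real_le_abs_countLt_sub_le A hkN hb) (F.law_real_le_collisionsLt_le A hAN hkN hc)))

theorem law_real_cardEstimate_lt_le_of_lt_card [Nontrivial U] {A : Finset U}
    (hAN : 8 * ((A.card : ℝ) - 1) ≤ N) {t : ℕ} (ht : 1944 ≤ t) (hAt : t < 2 / 3 * (A.card : ℝ)) :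
    F.law.real {s | F.cardEstimate t A s < 2 / 3 * A.card} ≤ 5 / 16 := by
  have hN : (1 : ℝ) ≤ N := by exact_mod_cast F.range_pos
  have ht' : (1944 : ℝ) ≤ t := by exact_mod_cast ht
  set m : ℝ := (A.card : ℝ)
  have hu : 0 < 2 / 3 * m := by linarith
  set k := ⌊t * N / (2 / 3 * m)⌋₊
  have k_le : (k : ℝ) ≤ t * N / (2 / 3 * m) := Nat.floor_le (by positivity)
  have lt_k : t * N / (2 / 3 * m) < k + 1 := Nat.lt_floor_add_one _
  have hkN : k ≤ N := by
    have : t * N / (2 / 3 * m) ≤ N := by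
      rw [div_le_iff₀ hu, mul_comm (N : ℝ)]
      gcongr
    exact_mod_cast k_le.trans this
  have hcancel : m * (t * N / (2 / 3 * m)) = 3 / 2 * t * N := by
    have : m ≠ 0 := by linarith
    field_simp
  have expectation_le : m * k / N ≤ 3 / 2 * t := by
    rw [div_le_iff₀ (by linarith), ← hcancel]
    gcongr
  have le_expectation : 3 / 2 * t - 9 / 8 ≤ m * k / N := by
    rw [le_div_iff₀ (by linarith)]
    nlinarith
  calc F.law.real {s | F.cardEstimate t A s < 2 / 3 * m}
      ≤ m * k / N / (t / 9) ^ 2 + m * k / N / (8 * (3 / 4 * t)) :=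
        F.law_real_cardEstimate_lt_le_add hAN (by omega) hu rfl hkN (by positivity)
          (by positivity) (by linarith)
    _ ≤ 3 / 2 * t / (t / 9) ^ 2 + 3 / 2 * t / (8 * (3 / 4 * t)) := by gcongr
    _ = 243 / 2 / t + 1 / 4 := by field_simp; ring
    _ ≤ 5 / 16 := by
        have : 243 / 2 / (t : ℝ) ≤ 1 / 16 := by
          rw [div_le_iff₀ (by linarith)]
          linarith
        linarith

theorem law_real_cardEstimate_notMem_Icc_le [Nontrivial U] (A : Finset U)
    (hAN : 8 * ((A.card : ℝ) - 1) ≤ N) {t : ℕ} (ht : 1944 ≤ t) :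
    F.law.real {s | F.cardEstimate t A s ∉ Set.Icc (2 / 3 * (A.card : ℝ)) (4 / 3 * A.card)} ≤
      3 / 8 := by
  rcases A.eq_empty_or_nonempty with rfl | hA
  · have : ∀ s, F.cardEstimate t ∅ s = 0 := fun s => by
      simp [cardEstimate, values, smallest, sketchEstimate, (by omega : 0 < t)]
    simp only [this, Finset.card_empty, Nat.cast_zero, mul_zero, Set.Icc_self,
      Set.mem_singleton_iff, not_true_eq_false, Set.ofPred_false, measureReal_empty]
    norm_num
  have too_small : F.law.real {s | F.cardEstimate t A s < 2 / 3 * A.card} ≤ 5 / 16 := by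
    rcases le_or_gt (2 / 3 * (A.card : ℝ)) t with hle | hlt
    · exact (F.law_real_cardEstimate_lt_le_of_card_le hA hAN (by omega) hle).trans (by norm_num)
    · exact F.law_real_cardEstimate_lt_le_of_lt_card hAN ht hlt
  have too_large : F.law.real {s | 4 / 3 * A.card < F.cardEstimate t A s} ≤ 1 / 16 := by
    refine (F.law_real_lt_cardEstimate_le hA (by omega)).trans ?_
    have : (1944 : ℝ) ≤ t := by exact_mod_cast ht
    rw [div_le_iff₀ (by linarith)]
    linarith
  have bad_subset : {s | F.cardEstimate t A s ∉ Set.Icc (2 / 3 * (A.card : ℝ)) (4 / 3 * A.card)} ⊆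
      {s | F.cardEstimate t A s < 2 / 3 * A.card} ∪
        {s | 4 / 3 * A.card < F.cardEstimate t A s} := by
    intro s hs
    rw [Set.mem_ofPred_eq, Set.mem_Icc, not_and_or, not_le, not_le] at hs
    exact hs
  have := (measureReal_mono (μ := F.law) bad_subset).trans (measureReal_union_le _ _)
  linarith

end HashFamily

section Amplification

open MeasureTheory ProbabilityTheory

theorem hasSubgaussianMGF_indicator_sub {Ω : Type*} [MeasurableSpace Ω] {μ : Measure Ω}
    [IsProbabilityMeasure μ] {s : Set Ω} (hs : MeasurableSet s) :
    HasSubgaussianMGF (fun x => s.indicator 1 x - μ.real s) (1 / 4) μ := by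
  have hmem : ∀ x, s.indicator (1 : Ω → ℝ) x ∈ Set.Icc 0 1 := fun x => by
    by_cases hx : x ∈ s <;> simp [hx]
  have h := hasSubgaussianMGF_of_mem_Icc (μ := μ) (measurable_one.indicator hs).aemeasurable
    (ae_of_all _ hmem)
  rw [integral_indicator_one hs] at h
  convert h using 1
  norm_num

theorem measureReal_pi_card_le_two_mul_card_filter_le {ι Ω : Type*} [Fintype ι]
    [MeasurableSpace Ω] {μ : Measure Ω} [IsProbabilityMeasure μ] {s : Set Ω}
    [DecidablePred (· ∈ s)] (hs : MeasurableSet s) {ε : ℝ} (hε : 0 ≤ ε)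
    (hμs : μ.real s ≤ 1 / 2 - ε) :
    (Measure.pi fun _ : ι => μ).real
        {ω | Fintype.card ι ≤ 2 * (Finset.univ.filter fun i => ω i ∈ s).card} ≤
      Real.exp (-(2 * ε ^ 2 * Fintype.card ι)) := by
  set X : Ω → ℝ := fun x => s.indicator 1 x - μ.real s
  have hX : Measurable X := (measurable_one.indicator hs).sub_const _
  have subgaussian (i : ι) :
      HasSubgaussianMGF (fun ω : ι → Ω => X (ω i)) (1 / 4) (Measure.pi fun _ : ι => μ) :=
    HasSubgaussianMGF.of_map (measurable_pi_apply i).aemeasurable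
      (by rw [(measurePreserving_eval (fun _ : ι => μ) i).map_eq]
          exact hasSubgaussianMGF_indicator_sub hs)
  calc (Measure.pi fun _ : ι => μ).real
        {ω | Fintype.card ι ≤ 2 * (Finset.univ.filter fun i => ω i ∈ s).card}
      ≤ (Measure.pi fun _ : ι => μ).real {ω | ε * Fintype.card ι ≤ ∑ i, X (ω i)} := by
        refine measureReal_mono fun ω hω => ?_
        have hsum : ∑ i, X (ω i) =
            (Finset.univ.filter fun i => ω i ∈ s).card - Fintype.card ι * μ.real s := by
          simp [X, Set.indicator_apply]
        have hω : (Fintype.card ι : ℝ) ≤ 2 * (Finset.univ.filter fun i => ω i ∈ s).card := by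
          exact_mod_cast hω
        rw [Set.mem_ofPred_eq, hsum]
        have := mul_le_mul_of_nonneg_left hμs (Nat.cast_nonneg (α := ℝ) (Fintype.card ι))
        linarith
    _ ≤ _ := HasSubgaussianMGF.measure_sum_ge_le_of_iIndepFun
        (iIndepFun_pi fun _ => hX.aemeasurable) (fun i _ => subgaussian i) (by positivity)
    _ = Real.exp (-(2 * ε ^ 2 * Fintype.card ι)) := by
        congr 1
        rcases (Fintype.card ι).eq_zero_or_pos with hι | hι
        · simp [hι]
        · rw [Finset.sum_const, Finset.card_univ, nsmul_eq_mul]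
          push_cast
          field_simp
          norm_num

theorem toOuterMeasure_uniformOfFintype_eq_uniformOn {α : Type*} [Fintype α] [Nonempty α]
    [MeasurableSpace α] [MeasurableSingletonClass α] (s : Set α) :
    (PMF.uniformOfFintype α).toOuterMeasure s = uniformOn Set.univ s := by
  classical
  rw [PMF.toOuterMeasure_uniformOfFintype_apply, uniformOn_univ,
    Measure.count_apply_finite s s.toFinite, Set.toFinite_toFinset, Set.toFinset_card]

theorem toOuterMeasure_uniformOfFintype_pi_card_le_two_mul_card_filter_le {ι Ω : Type*}
    [Fintype ι] [DecidableEq ι] [Fintype Ω] [Nonempty Ω] [MeasurableSpace Ω]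
    [MeasurableSingletonClass Ω] (s : Set Ω) [DecidablePred (· ∈ s)] {ε : ℝ} (hε : 0 ≤ ε)
    (hs : (uniformOn Set.univ).real s ≤ 1 / 2 - ε) :
    (PMF.uniformOfFintype (ι → Ω)).toOuterMeasure
        {ω | Fintype.card ι ≤ 2 * (Finset.univ.filter fun i => ω i ∈ s).card} ≤
      ENNReal.ofReal (Real.exp (-(2 * ε ^ 2 * Fintype.card ι))) := by
  rw [toOuterMeasure_uniformOfFintype_eq_uniformOn, ← Set.pi_univ (Set.univ : Set ι),
    uniformOn_pi, ENNReal.le_ofReal_iff_toReal_le (by finiteness) (by positivity)]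
  exact measureReal_pi_card_le_two_mul_card_filter_le s.toFinite.measurableSet hε hs

end Amplification

section FailureProbability

open scoped ENNReal

variable {α β : Type*}

theorem toOuterMeasure_univ_eq_one (p : PMF α) : p.toOuterMeasure Set.univ = 1 :=
  (p.toOuterMeasure_apply_eq_one_iff _).2 (Set.subset_univ _)

theorem one_sub_le_toOuterMeasure_of_compl_le {p : PMF α} {s : Set α} {ε : ℝ} (hε : 0 ≤ ε)
    (h : p.toOuterMeasure sᶜ ≤ ENNReal.ofReal ε) :
    ENNReal.ofReal (1 - ε) ≤ p.toOuterMeasure s := by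
  rw [ENNReal.ofReal_sub _ hε, ENNReal.ofReal_one, tsub_le_iff_right,
    ← toOuterMeasure_univ_eq_one p, ← Set.union_compl_self s]
  refine (MeasureTheory.measure_union_le _ _).trans ?_
  gcongr

theorem toOuterMeasure_exists_le {ι : Type*} [Fintype ι] {p : PMF α} {q : ι → α → Prop} {x : ℝ≥0∞}
    (h : ∀ i, p.toOuterMeasure {a | q i a} ≤ x) :
    p.toOuterMeasure {a | ∃ i, q i a} ≤ Fintype.card ι * x := by
  rw [Set.ofPred_exists]
  refine (MeasureTheory.measure_iUnion_fintype_le _ _).trans ?_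
  refine (Finset.sum_le_sum fun i _ => h i).trans_eq ?_
  rw [Finset.sum_const, nsmul_eq_mul, Finset.card_univ]

theorem toOuterMeasure_bind_le_mul_add (p : PMF α) (f : α → PMF β) (s : Set β) (bad : Set α)
    (x y : ℝ≥0∞) (h_bad : ∀ a ∈ bad, (f a).toOuterMeasure s ≤ x + y)
    (h_good : ∀ a ∈ p.support, a ∉ bad → (f a).toOuterMeasure s ≤ y) :
    (p.bind f).toOuterMeasure s ≤ p.toOuterMeasure bad * x + y := by
  rw [PMF.toOuterMeasure_bind_apply, PMF.toOuterMeasure_apply, ← ENNReal.tsum_mul_right]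
  calc ∑' a, p a * (f a).toOuterMeasure s
      ≤ ∑' a, (bad.indicator p a * x + p a * y) := by
        refine ENNReal.tsum_le_tsum fun a => ?_
        by_cases ha : a ∈ bad
        · rw [Set.indicator_of_mem ha, ← mul_add]
          gcongr
          exact h_bad a ha
        · rw [Set.indicator_of_notMem ha, zero_mul, zero_add]
          by_cases hp : a ∈ p.support
          · gcongr
            exact h_good a hp ha
          · rw [(p.apply_eq_zero_iff a).2 hp, zero_mul, zero_mul]
    _ = ∑' a, bad.indicator p a * x + y := by
        rw [ENNReal.tsum_add, ENNReal.tsum_mul_right (a := y), p.tsum_coe, one_mul]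

theorem toOuterMeasure_bind_le_add {p : PMF α} {f : α → PMF β} {s : Set β} {bad : Set α}
    {x y : ℝ≥0∞} (h_bad : p.toOuterMeasure bad ≤ x)
    (h_good : ∀ a ∈ p.support, a ∉ bad → (f a).toOuterMeasure s ≤ y) :
    (p.bind f).toOuterMeasure s ≤ x + y := by
  refine (toOuterMeasure_bind_le_mul_add p f s bad 1 y (fun a _ => ?_) h_good).trans ?_
  · refine (MeasureTheory.measure_mono (Set.subset_univ s)).trans ?_
    exact (toOuterMeasure_univ_eq_one _).trans_le le_self_add
  · rw [mul_one]
    gcongr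

theorem toOuterMeasure_bind_le {p : PMF α} {f : α → PMF β} {s : Set β} {y : ℝ≥0∞}
    (h : ∀ a ∈ p.support, (f a).toOuterMeasure s ≤ y) : (p.bind f).toOuterMeasure s ≤ y := by
  rw [← zero_add y]
  exact toOuterMeasure_bind_le_add (bad := ∅) (MeasureTheory.measure_empty).le fun a ha _ => h a ha

theorem toOuterMeasure_bind_pure_le {p : PMF α} {f : α → β} {s : Set β} {bad : Set α} {x : ℝ≥0∞}
    (h_bad : p.toOuterMeasure bad ≤ x) (h_good : ∀ a ∉ bad, f a ∉ s) :
    (p.bind fun a => PMF.pure (f a)).toOuterMeasure s ≤ x := by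
  rw [← add_zero x]
  refine toOuterMeasure_bind_le_add h_bad fun a _ ha => ?_
  rw [PMF.toOuterMeasure_pure_apply, if_neg (h_good a ha)]

end FailureProbability

theorem HashFamily.toOuterMeasure_median_cardEstimate_notMem_Icc_le {U : Type*} [Nontrivial U]
    {N : ℕ} (F : HashFamily U N) (A : Finset U) (hAN : 8 * ((A.card : ℝ) - 1) ≤ N) {t : ℕ}
    (ht : 1944 ≤ t) (r : ℕ) :
    (PMF.uniformOfFintype (Fin r → F.Seed)).toOuterMeasure
        {σ | median (fun i => F.cardEstimate t A (σ i)) ∉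
          Set.Icc (2 / 3 * (A.card : ℝ)) (4 / 3 * A.card)} ≤
      ENNReal.ofReal (Real.exp (-(r / 32))) := by
  set s := {s : F.Seed | F.cardEstimate t A s ∉ Set.Icc (2 / 3 * (A.card : ℝ)) (4 / 3 * A.card)}
  have hs : F.law.real s ≤ 1 / 2 - 1 / 8 :=
    (F.law_real_cardEstimate_notMem_Icc_le A hAN ht).trans (by norm_num)
  have h := toOuterMeasure_uniformOfFintype_pi_card_le_two_mul_card_filter_le (ι := Fin r) s
    (by norm_num) hs
  rw [Fintype.card_fin, show -(2 * (1 / 8) ^ 2 * (r : ℝ)) = -(r / 32) by ring] at h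
  refine le_trans (MeasureTheory.measure_mono fun σ hσ => ?_) h
  by_contra hlt
  exact hσ (median_mem_Icc (not_le.1 hlt))

namespace Dag

variable {V : Type*} [Fintype V]

theorem eight_mul_card_anc_sub_one_le (H : Dag V) (v : V) :
    8 * (((H.anc v).card : ℝ) - 1) ≤ Fintype.card V ^ 3 := by
  have hcard : ((H.anc v).card : ℝ) ≤ Fintype.card V := Nat.cast_le.2 (Finset.card_le_univ _)
  rcases le_or_gt (Fintype.card V) 1 with hV | hV
  · have hV : (Fintype.card V : ℝ) ≤ 1 := by exact_mod_cast hV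
    have : (0 : ℝ) ≤ Fintype.card V ^ 3 := by positivity
    linarith
  · have hV : (2 : ℝ) ≤ Fintype.card V := by exact_mod_cast hV
    nlinarith [mul_nonneg (sub_nonneg.2 hV) (sub_nonneg.2 hV), sq_nonneg (Fintype.card V : ℝ)]

theorem eight_mul_card_ancEdges_sub_one_le [DecidableEq V] (H : Dag V) (S : Finset V) :
    8 * (((H.ancEdges S).card : ℝ) - 1) ≤ Fintype.card V ^ 3 := by
  have hcard : 2 * ((H.ancEdges S).card : ℝ) ≤ Fintype.card V * (Fintype.card V - 1) := by
    have h : 2 * ((H.ancEdges S).card : ℝ) ≤ (Fintype.card V * (Fintype.card V - 1) : ℕ) := by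
      exact_mod_cast H.card_ancEdges_le S
    rwa [Nat.mul_sub_one, Nat.cast_sub (Nat.le_mul_self _), Nat.cast_mul, ← mul_sub_one] at h
  nlinarith [mul_nonneg (Fintype.card V).cast_nonneg (sq_nonneg ((Fintype.card V : ℝ) - 2))]

end Dag

namespace EstimatorParams

open scoped ENNReal

variable {V : Type*} [DecidableEq V]

/-- All estimates are correct up to a relative error of `ε = 1/3`. -/
def IsAccurate (H : Dag V) (e : (V → ℝ) × (V → ℝ)) : Prop :=
  ∀ v, e.1 v ∈ Set.Icc (2 / 3 * ((H.anc v).card : ℝ)) (4 / 3 * (H.anc v).card) ∧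
    e.2 v ∈ Set.Icc (2 / 3 * ((H.ancEdges {v}).card : ℝ)) (4 / 3 * (H.ancEdges {v}).card)

/-- The bound that Hoeffding's inequality for the median of `P.r` estimates gives for the
probability that a single number is estimated with a relative error of more than `1/3`. -/
noncomputable def errorProb {V : Type*} (P : EstimatorParams V) : ℝ≥0∞ :=
  ENNReal.ofReal (Real.exp (-(P.r / 32)))

theorem vertexEstimate_eq [Finite V] (P : EstimatorParams V) (H : Dag V)
    (σ : Fin P.r → P.vertexHash.Seed) (v : V) :
    P.vertexEstimate H σ v =
      median fun i => P.vertexHash.cardEstimate P.t (H.anc v) (σ i) := by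
  simp only [vertexEstimate, sketch_eq_smallest, HashFamily.cardEstimate, HashFamily.values,
    Finset.biUnion_singleton]

theorem edgeEstimate_eq [Finite V] (P : EstimatorParams V) (H : Dag V)
    (τ : Fin P.r → P.edgeHash.Seed) (v : V) :
    P.edgeEstimate H τ v =
      median fun i => P.edgeHash.cardEstimate P.t (H.ancEdges {v}) (τ i) := by
  simp only [edgeEstimate, sketch_eq_smallest, HashFamily.cardEstimate, HashFamily.values,
    Dag.ancEdges_eq_biUnion, Dag.ancSet_singleton, Finset.biUnion_image, Finset.image_image,
    Function.comp_def]

theorem toOuterMeasure_not_isAccurate_le [Fintype V] [Nontrivial V] (P : EstimatorParams V)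
    (hrange : Fintype.card V ^ 3 ≤ P.range) (ht : 1944 ≤ P.t) (H : Dag V) :
    (P.estimate H).toOuterMeasure {e | ¬ IsAccurate H e} ≤
      2 * Fintype.card V * P.errorProb := by
  have hrange : (Fintype.card V : ℝ) ^ 3 ≤ P.range := by exact_mod_cast hrange
  have vertex_inaccurate_le := toOuterMeasure_exists_le fun v =>
    P.vertexHash.toOuterMeasure_median_cardEstimate_notMem_Icc_le (H.anc v)
      ((H.eight_mul_card_anc_sub_one_le v).trans hrange) ht P.r
  have edge_inaccurate_le := toOuterMeasure_exists_le fun v =>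
    P.edgeHash.toOuterMeasure_median_cardEstimate_notMem_Icc_le (H.ancEdges {v})
      ((H.eight_mul_card_ancEdges_sub_one_le {v}).trans hrange) ht P.r
  rw [two_mul, add_mul]
  refine toOuterMeasure_bind_le_add vertex_inaccurate_le fun σ _ hσ => ?_
  refine toOuterMeasure_bind_pure_le edge_inaccurate_le fun τ hτ => ?_
  simp only [Set.mem_ofPred_eq, not_exists, not_not] at hσ hτ ⊢
  intro v
  exact ⟨by simpa only [vertexEstimate_eq] using hσ v, by simpa only [edgeEstimate_eq] using hτ v⟩

end EstimatorParams

section Freshness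

variable {V : Type*} [DecidableEq V]

theorem IsFresh.anti {H : Dag V} {γ : ℝ} {B B' : Finset V} {v : V} (hB : B ⊆ B')
    (hv : IsFresh H γ B' v) : IsFresh H γ B v :=
  ⟨hv.1.trans_le (Nat.cast_le.2 (Finset.card_le_card
      (Finset.sdiff_subset_sdiff le_rfl (Dag.ancSet_mono hB)))),
    hv.2.trans_le (Nat.cast_le.2 (Finset.card_le_card
      (Finset.sdiff_subset_sdiff le_rfl (Dag.ancEdges_mono hB))))⟩

open Classical in
/-- The vertices of the bucket `K` that are fresh with respect to `B`. -/
noncomputable def freshIn (H : Dag V) (γ : ℝ) (K B : Finset V) : Finset V :=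
  K.filter (IsFresh H γ B)

theorem mem_freshIn {H : Dag V} {γ : ℝ} {K B : Finset V} {v : V} :
    v ∈ freshIn H γ K B ↔ v ∈ K ∧ IsFresh H γ B v := by
  simp only [freshIn, Finset.mem_filter]

theorem card_freshIn_le (H : Dag V) (γ : ℝ) (K B : Finset V) :
    (freshIn H γ K B).card ≤ K.card :=
  Finset.card_le_card fun _ hv => (mem_freshIn.1 hv).1

theorem card_freshIn_le_card_freshIn {H : Dag V} {γ : ℝ} {K K' B B' : Finset V} (hK : K' ⊆ K)
    (hB : B ⊆ B') : (freshIn H γ K' B').card ≤ (freshIn H γ K B).card :=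
  Finset.card_le_card fun _ hv =>
    mem_freshIn.2 ⟨hK (mem_freshIn.1 hv).1, (mem_freshIn.1 hv).2.anti hB⟩

theorem le_two_mul_of_relative_errors {γ x y e e' : ℝ} (hγ : 0 ≤ γ) (hyx : y ≤ γ * x)
    (he : 2 / 3 * x ≤ e) (he' : e' ≤ 4 / 3 * y) : e' ≤ 2 * γ * e := by
  linarith [mul_le_mul_of_nonneg_left he hγ]

theorem isFresh_of_isAccurate {H : Dag V} {γ : ℝ} (hγ : 0 ≤ γ) {B : Finset V}
    {e e' : (V → ℝ) × (V → ℝ)} (he : EstimatorParams.IsAccurate H e)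
    (he' : EstimatorParams.IsAccurate (H.remove (H.ancSet B)) e') {v : V}
    (hv : ¬ (e'.1 v ≤ 2 * γ * e.1 v ∨ e'.2 v ≤ 2 * γ * e.2 v)) : IsFresh H γ B v := by
  by_contra hstale
  rw [IsFresh, not_and_or, not_lt, not_lt] at hstale
  refine hv (hstale.imp (fun h => ?_) fun h => ?_)
  · refine le_two_mul_of_relative_errors hγ h (he v).1.1 ((he' v).1.2.trans ?_)
    gcongr
    exact H.anc_remove_subset _ _
  · refine le_two_mul_of_relative_errors hγ h (he v).2.1 ((he' v).2.2.trans ?_)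
    gcongr
    exact H.ancEdges_remove_subset _ _

theorem subset_of_mem_support_prune [Finite V] {P : EstimatorParams V} {H : Dag V} {γ : ℝ}
    {S R : BatchState V} (hR : R ∈ (prune P H γ S).support) (i : ℕ) : R.K i ⊆ S.K i := by
  simp only [prune, PMF.mem_support_bind_iff, PMF.mem_support_pure_iff] at hR
  obtain ⟨e, -, e', -, rfl⟩ := hR
  exact Finset.filter_subset _ _

theorem toOuterMeasure_prune_not_subset_freshIn_le [Fintype V] [Nontrivial V]
    (P : EstimatorParams V) (hrange : Fintype.card V ^ 3 ≤ P.range) (ht : 1944 ≤ P.t) (H : Dag V)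
    {γ : ℝ} (hγ : 0 ≤ γ) (S : BatchState V) :
    (prune P H γ S).toOuterMeasure {R | ¬ ∀ i, R.K i ⊆ freshIn H γ (S.K i) S.B} ≤
      4 * Fintype.card V * P.errorProb := by
  rw [show (4 : ENNReal) = 2 + 2 by norm_num, add_mul, add_mul]
  refine toOuterMeasure_bind_le_add (P.toOuterMeasure_not_isAccurate_le hrange ht H)
    fun e _ he => ?_
  refine toOuterMeasure_bind_pure_le (P.toOuterMeasure_not_isAccurate_le hrange ht _)
    fun e' he' => ?_
  simp only [Set.mem_ofPred_eq, not_not] at he he' ⊢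
  intro i v hv
  obtain ⟨hvK, hv⟩ := Finset.mem_filter.1 hv
  exact mem_freshIn.2 ⟨hvK, isFresh_of_isAccurate hγ he he' hv⟩

end Freshness

section Sampling

open scoped ENNReal

variable {V : Type*} [DecidableEq V] {H : Dag V} {γ : ℝ} {N : ℕ}

theorem exists_erase_of_mem_support_sampleBucket {K B : Finset V} {s : ℕ}
    {R : Finset V × Finset V} (hR : R ∈ (sampleBucket H γ N K B s).support) (hs : s < N)
    (hK : K.Nonempty) :
    ∃ v ∈ K, ∃ B' s', B ⊆ B' ∧ R ∈ (sampleBucket H γ N (K.erase v) B' s').support := by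
  rw [sampleBucket, dif_pos ⟨hs, hK⟩, PMF.mem_support_bind_iff] at hR
  obtain ⟨v, -, hR⟩ := hR
  split_ifs at hR
  · exact ⟨v, v.2, _, _, Finset.subset_insert _ _, hR⟩
  · exact ⟨v, v.2, _, _, subset_rfl, hR⟩

theorem subset_of_mem_support_sampleBucket {K B : Finset V} {s : ℕ} {R : Finset V × Finset V}
    (hR : R ∈ (sampleBucket H γ N K B s).support) : R.1 ⊆ K ∧ B ⊆ R.2 := by
  induction K using Finset.strongInduction generalizing B s with
  | H K ih =>
    by_cases h : s < N ∧ K.Nonempty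
    · obtain ⟨v, hv, B', s', hB, hR⟩ := exists_erase_of_mem_support_sampleBucket hR h.1 h.2
      obtain ⟨hK, hB'⟩ := ih _ (Finset.erase_ssubset hv) hR
      exact ⟨hK.trans (Finset.erase_subset _ _), hB.trans hB'⟩
    · rw [sampleBucket, dif_neg h, PMF.mem_support_pure_iff] at hR
      subst hR
      exact ⟨subset_rfl, subset_rfl⟩

theorem card_lt_of_mem_support_sampleBucket {K B : Finset V} {s : ℕ} {R : Finset V × Finset V}
    (hR : R ∈ (sampleBucket H γ N K B s).support) (hs : s < N) (hK : K.Nonempty) :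
    R.1.card < K.card := by
  obtain ⟨v, hv, B', s', -, hR⟩ := exists_erase_of_mem_support_sampleBucket hR hs hK
  exact (Finset.card_le_card (subset_of_mem_support_sampleBucket hR).1).trans_lt
    (Finset.card_erase_lt_of_mem hv)

theorem toOuterMeasure_uniformOfFintype_coe {α : Type*} (K : Finset α) [Nonempty K]
    (p : α → Prop) [DecidablePred p] :
    (PMF.uniformOfFintype K).toOuterMeasure {v | p v} = (K.filter p).card / K.card := by
  rw [PMF.toOuterMeasure_uniformOfFintype_apply, Fintype.card_coe]
  congr 2
  rw [Fintype.card_subtype, Finset.univ_eq_attach]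
  simp only [Set.mem_ofPred_eq]
  rw [Finset.filter_attach, Finset.card_map, Finset.card_attach]

theorem toOuterMeasure_uniformOfFintype_not_isFresh_le {K B : Finset V} [Nonempty K] {M : ℕ}
    (hKM : K.card ≤ M) {θ : ℝ} (hθ : θ ≤ 1) (hfresh : (1 - θ) * M < (freshIn H γ K B).card) :
    (PMF.uniformOfFintype K).toOuterMeasure {v | ¬ IsFresh H γ B v} ≤ ENNReal.ofReal θ := by
  classical
  have hK : (0 : ℝ) < K.card := by
    exact_mod_cast Finset.card_pos.2 (Finset.nonempty_coe_sort.1 ‹_›)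
  have hcard : ((freshIn H γ K B).card : ℝ) + (K.filter fun v => ¬ IsFresh H γ B v).card =
      K.card := by
    exact_mod_cast Finset.card_filter_add_card_filter_not (s := K) (IsFresh H γ B)
  have hKM : (K.card : ℝ) ≤ M := by exact_mod_cast hKM
  have hstale : ((K.filter fun v => ¬ IsFresh H γ B v).card : ℝ) ≤ θ * K.card := by
    linarith [mul_le_mul_of_nonneg_left hKM (sub_nonneg.2 hθ)]
  rw [toOuterMeasure_uniformOfFintype_coe K fun v => ¬ IsFresh H γ B v,
    ← ENNReal.ofReal_natCast, ← ENNReal.ofReal_natCast, ← ENNReal.ofReal_div_of_pos hK]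
  exact ENNReal.ofReal_le_ofReal ((div_le_iff₀ hK).2 hstale)

theorem toOuterMeasure_sampleBucket_le_mul_add {K B : Finset V} {s : ℕ} (hs : s < N)
    [hK : Nonempty K] (E : Set (Finset V × Finset V)) {p x y : ℝ≥0∞}
    (hp : (PMF.uniformOfFintype K).toOuterMeasure {v | ¬ IsFresh H γ B v} ≤ p)
    (h_stale : ∀ v ∈ K,
      (sampleBucket H γ N (K.erase v) B (s + 1)).toOuterMeasure E ≤ x + y)
    (h_fresh : ∀ v ∈ K,
      (sampleBucket H γ N (K.erase v) (insert v B) 0).toOuterMeasure E ≤ y) :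
    (sampleBucket H γ N K B s).toOuterMeasure E ≤ p * x + y := by
  classical
  rw [sampleBucket, dif_pos ⟨hs, Finset.nonempty_coe_sort.1 hK⟩]
  refine (toOuterMeasure_bind_le_mul_add _ _ E {v : K | ¬ IsFresh H γ B v} x y
    (fun v hv => ?_) fun v _ hv => ?_).trans (by gcongr)
  · rw [if_neg hv]
    exact h_stale v v.2
  · rw [if_pos (not_not.1 hv)]
    exact h_fresh v v.2

/- The bound is a potential: while more than `(1 - θ) * M` vertices are fresh, a sampled vertex is
stale with probability at most `θ`, which gains a factor `θ` in the first term, and a fresh vertex,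
which resets `s`, is paid for by the decrease of `K.card`. -/
theorem toOuterMeasure_sampleBucket_lt_card_freshIn_le {θ : ℝ} (hθ : θ ≤ 1) {M : ℕ}
    {K B : Finset V} {s : ℕ} (hK : K.card ≤ M) (hs : s ≤ N) :
    (sampleBucket H γ N K B s).toOuterMeasure
        {R | (1 - θ) * M < (freshIn H γ R.1 R.2).card} ≤
      ENNReal.ofReal θ ^ (N - s) + K.card * ENNReal.ofReal θ ^ N := by
  induction K using Finset.strongInduction generalizing B s with
  | H K ih =>
    rcases le_or_gt ((freshIn H γ K B).card : ℝ) ((1 - θ) * M) with hfew | hmany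
    · refine le_of_eq_of_le ((PMF.toOuterMeasure_apply_eq_zero_iff _ _).2 ?_) zero_le
      refine Set.disjoint_left.2 fun R hR hbad => not_lt.2 (le_trans ?_ hfew) hbad
      obtain ⟨hRK, hBR⟩ := subset_of_mem_support_sampleBucket hR
      exact Nat.cast_le.2 (card_freshIn_le_card_freshIn hRK hBR)
    have hKpos : 0 < K.card := by
      have : (0 : ℝ) < (freshIn H γ K B).card :=
        (mul_nonneg (sub_nonneg.2 hθ) M.cast_nonneg).trans_lt hmany
      exact (Nat.cast_pos.1 this).trans_le (card_freshIn_le H γ K B)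
    have : Nonempty K := (Finset.card_pos.1 hKpos).to_subtype
    rcases hs.eq_or_lt with rfl | hs
    · rw [Nat.sub_self, pow_zero]
      refine (MeasureTheory.measure_mono (Set.subset_univ _)).trans ?_
      exact (toOuterMeasure_univ_eq_one _).trans_le le_self_add
    have card_erase_le : ∀ v, (K.erase v).card ≤ M := fun v => (Finset.card_erase_le).trans hK
    have hpow : ENNReal.ofReal θ * ENNReal.ofReal θ ^ (N - (s + 1)) =
        ENNReal.ofReal θ ^ (N - s) := by
      rw [← pow_succ', Nat.sub_add_eq, Nat.sub_add_cancel (Nat.sub_pos_of_lt hs)]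
    rw [← hpow]
    refine toOuterMeasure_sampleBucket_le_mul_add hs _
      (toOuterMeasure_uniformOfFintype_not_isFresh_le hK hθ hmany) (fun v hv => ?_) fun v hv => ?_
    · refine (ih _ (Finset.erase_ssubset hv) (card_erase_le v) hs).trans ?_
      gcongr
      exact Finset.erase_subset _ _
    · refine (ih _ (Finset.erase_ssubset hv) (card_erase_le v) (Nat.zero_le N)).trans_eq ?_
      rw [← Finset.card_erase_add_one hv, Nat.cast_add_one, Nat.sub_zero]
      ring

theorem toOuterMeasure_sampleBucket_zero_lt_card_freshIn_le {θ : ℝ} (hθ : θ ≤ 1)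
    {K B : Finset V} :
    (sampleBucket H γ N K B 0).toOuterMeasure
        {R | (1 - θ) * K.card < (freshIn H γ R.1 R.2).card} ≤
      K.card * (2 * ENNReal.ofReal θ ^ N) := by
  rcases K.eq_empty_or_nonempty with rfl | hK
  · rw [sampleBucket, dif_neg (by simp), PMF.toOuterMeasure_pure_apply, if_neg]
    · exact zero_le
    · simp [freshIn]
  · refine (toOuterMeasure_sampleBucket_lt_card_freshIn_le hθ le_rfl (Nat.zero_le N)).trans ?_
    rw [Nat.sub_zero, two_mul, mul_add]
    gcongr
    exact le_mul_of_one_le_left zero_le (by exact_mod_cast hK.card_pos)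

end Sampling

namespace BatchState

variable {V : Type*}

/-- The total size of the buckets `K 1, …, K k`, by which the progress of the outer loop is
measured. -/
def size (k : ℕ) (S : BatchState V) : ℕ := ∑ i ∈ Finset.Icc 1 k, (S.K i).card

theorem allEmpty_iff_size_eq_zero {k : ℕ} {S : BatchState V} : AllEmpty k S ↔ S.size k = 0 := by
  simp only [AllEmpty, size, Finset.sum_eq_zero_iff, Finset.card_eq_zero]

end BatchState

theorem size_initialBuckets_le {V : Type*} [Fintype V] (H : Dag V) (e : V → ℝ) (B : Finset V)
    (k : ℕ) : (BatchState.mk (initialBuckets H e) B).size k ≤ Fintype.card V := by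
  classical
  have hdisj : ∀ i j, 1 ≤ i → i < j →
      Disjoint (initialBuckets H e i) (initialBuckets H e j) := by
    refine fun i j hi hij => Finset.disjoint_left.2 fun v hvi hvj => ?_
    have hlt : e v < 2 ^ (i + 1) := (Finset.mem_filter.1 hvi).2.2
    have hle : 2 ^ j ≤ e v := (Finset.mem_filter.1 hvj).2.1.resolve_left (by lia)
    have hpow : (2 : ℝ) ^ (i + 1) ≤ 2 ^ j := pow_le_pow_right₀ one_le_two hij
    linarith
  rw [BatchState.size, ← Finset.card_biUnion]
  · exact Finset.card_le_univ _
  · intro i hi j hj hij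
    rcases hij.lt_or_gt with hij | hij
    · exact hdisj i j (Finset.mem_Icc.1 hi).1 hij
    · exact (hdisj j i (Finset.mem_Icc.1 hj).1 hij).symm

section OuterLoop

open scoped ENNReal

variable {V : Type*} [DecidableEq V] {H : Dag V} {γ : ℝ} {N k : ℕ} {S R : BatchState V}

theorem subset_of_mem_support_sampleBuckets (hR : R ∈ (sampleBuckets H γ N k S).support) :
    S.B ⊆ R.B ∧ ∀ i, R.K i ⊆ S.K i := by
  induction k generalizing S with
  | zero =>
    rw [sampleBuckets, PMF.mem_support_pure_iff] at hR
    subst hR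
    exact ⟨subset_rfl, fun _ => subset_rfl⟩
  | succ k ih =>
    rw [sampleBuckets, PMF.mem_support_bind_iff] at hR
    obtain ⟨Q, hQ, hR⟩ := hR
    obtain ⟨hQK, hBQ⟩ := subset_of_mem_support_sampleBucket hQ
    obtain ⟨hB, hK⟩ := ih hR
    refine ⟨hBQ.trans hB, fun i => (hK i).trans ?_⟩
    rcases eq_or_ne i (k + 1) with rfl | hi
    · simpa only [Function.update_self] using hQK
    · simp only [Function.update_of_ne hi, subset_refl]

theorem card_lt_of_mem_support_sampleBuckets (hN : 0 < N)
    (hR : R ∈ (sampleBuckets H γ N k S).support) {i : ℕ} (hi : i ∈ Finset.Icc 1 k)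
    (hne : (S.K i).Nonempty) : (R.K i).card < (S.K i).card := by
  induction k generalizing S with
  | zero => simp at hi
  | succ k ih =>
    rw [sampleBuckets, PMF.mem_support_bind_iff] at hR
    obtain ⟨Q, hQ, hR⟩ := hR
    rcases eq_or_ne i (k + 1) with rfl | hik
    · refine (Finset.card_le_card ((subset_of_mem_support_sampleBuckets hR).2 _)).trans_lt ?_
      simpa only [Function.update_self] using card_lt_of_mem_support_sampleBucket hQ hN hne
    · rw [← Finset.insert_Icc_right_eq_Icc_add_one (by lia), Finset.mem_insert] at hi
      have hlt := ih hR (hi.resolve_left hik)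
      simp only [Function.update_of_ne hik] at hlt
      exact hlt hne

theorem toOuterMeasure_sampleBuckets_exists_lt_card_freshIn_le {θ : ℝ} (hθ : θ ≤ 1) :
    (sampleBuckets H γ N k S).toOuterMeasure {R | ∃ i ∈ Finset.Icc 1 k,
        (1 - θ) * (S.K i).card < (freshIn H γ (R.K i) R.B).card} ≤
      (∑ i ∈ Finset.Icc 1 k, (S.K i).card : ℕ) * (2 * ENNReal.ofReal θ ^ N) := by
  induction k generalizing S with
  | zero => simp [sampleBuckets]
  | succ k ih =>
    rw [sampleBuckets, Finset.sum_Icc_succ_top (Nat.le_add_left 1 k), Nat.cast_add, add_mul,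
      add_comm (_ * _)]
    refine toOuterMeasure_bind_le_add
      (toOuterMeasure_sampleBucket_zero_lt_card_freshIn_le hθ) fun Q _ hQ => ?_
    have hupdate : ∀ i ∈ Finset.Icc 1 k, Function.update S.K (k + 1) Q.1 i = S.K i :=
      fun i hi => Function.update_of_ne (by have := Finset.mem_Icc.1 hi; lia) _ _
    have hrest := ih (S := ⟨Function.update S.K (k + 1) Q.1, Q.2⟩)
    rw [Finset.sum_congr rfl fun i hi => congrArg Finset.card (hupdate i hi)] at hrest
    refine le_trans (PMF.toOuterMeasure_mono _ ?_) hrest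
    rintro R ⟨⟨i, hi, hbad⟩, hR⟩
    obtain ⟨hB, hK⟩ := subset_of_mem_support_sampleBuckets hR
    rcases eq_or_ne i (k + 1) with rfl | hik
    · have hRQ := hK (k + 1)
      simp only [Function.update_self] at hRQ
      exact absurd (hbad.trans_le (Nat.cast_le.2 (card_freshIn_le_card_freshIn hRQ hB))) hQ
    · have hi : i ∈ Finset.Icc 1 k := by
        have := Finset.mem_Icc.1 hi
        exact Finset.mem_Icc.2 (by lia)
      exact ⟨i, hi, by simpa only [hupdate i hi] using hbad⟩

/-- One iteration of the outer `while` loop: sampling, then pruning. -/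
noncomputable def iteration [Finite V] (P : EstimatorParams V) (H : Dag V) (γ : ℝ) (N k : ℕ)
    (S : BatchState V) : PMF (BatchState V) :=
  (sampleBuckets H γ N k S).bind (prune P H γ)

theorem toOuterMeasure_whileLoop_not_allEmpty_eq_zero [Finite V] (P : EstimatorParams V) (T : ℕ)
    (hS : AllEmpty k S) :
    (whileLoop P H γ N k T S).toOuterMeasure {R | ¬ AllEmpty k R} = 0 := by
  have hpure : whileLoop P H γ N k T S = PMF.pure S := by
    cases T with
    | zero => rw [whileLoop]
    | succ T => rw [whileLoop, if_pos hS]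
  rw [hpure, PMF.toOuterMeasure_pure_apply]
  exact if_neg (not_not.2 hS)

theorem whileLoop_succ_of_not_allEmpty [Finite V] (P : EstimatorParams V) (T : ℕ)
    (hS : ¬ AllEmpty k S) :
    whileLoop P H γ N k (T + 1) S = (iteration P H γ N k S).bind (whileLoop P H γ N k T) := by
  rw [whileLoop, if_neg hS, iteration, PMF.bind_bind]

theorem size_lt_of_mem_support_iteration [Finite V] {P : EstimatorParams V} (hN : 0 < N)
    (hS : ¬ AllEmpty k S) (hR : R ∈ (iteration P H γ N k S).support) : R.size k < S.size k := by
  obtain ⟨Q, hQ, hR⟩ := (PMF.mem_support_bind_iff _ _ _).1 hR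
  simp only [AllEmpty, not_forall] at hS
  obtain ⟨i, hi, hne⟩ := hS
  have hRS : ∀ j, (R.K j).card ≤ (Q.K j).card := fun j =>
    Finset.card_le_card (subset_of_mem_support_prune hR j)
  refine Finset.sum_lt_sum (fun j _ => (hRS j).trans ?_) ⟨i, hi, (hRS i).trans_lt ?_⟩
  · exact Finset.card_le_card ((subset_of_mem_support_sampleBuckets hQ).2 j)
  · exact card_lt_of_mem_support_sampleBuckets hN hQ hi (Finset.nonempty_iff_ne_empty.2 hne)

section FailureBounds

variable [Fintype V] [Nontrivial V] {P : EstimatorParams V}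

theorem toOuterMeasure_iteration_lt_size_le (hrange : Fintype.card V ^ 3 ≤ P.range)
    (ht : 1944 ≤ P.t) (hγ : 0 ≤ γ) {θ : ℝ} (hθ : θ ≤ 1) :
    (iteration P H γ N k S).toOuterMeasure {R | (1 - θ) * S.size k < R.size k} ≤
      S.size k * (2 * ENNReal.ofReal θ ^ N) + 4 * Fintype.card V * P.errorProb := by
  refine toOuterMeasure_bind_le_add
    (toOuterMeasure_sampleBuckets_exists_lt_card_freshIn_le hθ) fun Q _ hQ => ?_
  refine le_trans (MeasureTheory.measure_mono ?_)
    (toOuterMeasure_prune_not_subset_freshIn_le P hrange ht H hγ Q)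
  simp only [Set.mem_ofPred_eq, not_exists, not_and, not_lt] at hQ
  intro R hR hfresh
  rw [Set.mem_ofPred_eq, ← not_le] at hR
  refine hR ?_
  rw [BatchState.size, BatchState.size, Nat.cast_sum, Nat.cast_sum, Finset.mul_sum]
  exact Finset.sum_le_sum fun i hi =>
    (Nat.cast_le.2 (Finset.card_le_card (hfresh i))).trans (hQ i hi)

theorem toOuterMeasure_whileLoop_not_allEmpty_le (hrange : Fintype.card V ^ 3 ≤ P.range)
    (ht : 1944 ≤ P.t) (hγ : 0 ≤ γ) (hN : 0 < N) {θ : ℝ} (hθ : θ ≤ 1) {T : ℕ}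
    (hT : (1 - θ) ^ T * S.size k < 1) :
    (whileLoop P H γ N k T S).toOuterMeasure {R | ¬ AllEmpty k R} ≤
      S.size k *
        (S.size k * (2 * ENNReal.ofReal θ ^ N) + 4 * Fintype.card V * P.errorProb) := by
  induction T generalizing S with
  | zero =>
    rw [pow_zero, one_mul, Nat.cast_lt_one] at hT
    have hS : AllEmpty k S := BatchState.allEmpty_iff_size_eq_zero.2 hT
    exact (toOuterMeasure_whileLoop_not_allEmpty_eq_zero P 0 hS).trans_le zero_le
  | succ T ih =>
    by_cases hS : AllEmpty k S
    · exact (toOuterMeasure_whileLoop_not_allEmpty_eq_zero P _ hS).trans_le zero_le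
    have hpos : 1 ≤ S.size k :=
      Nat.one_le_iff_ne_zero.2 (mt BatchState.allEmpty_iff_size_eq_zero.2 hS)
    set q := S.size k * (2 * ENNReal.ofReal θ ^ N) + 4 * Fintype.card V * P.errorProb with hq
    have hsplit : S.size k * q = q + (S.size k - 1 : ℕ) * q := by
      rw [← one_add_mul, ← Nat.cast_one_add, Nat.add_sub_cancel' hpos]
    rw [whileLoop_succ_of_not_allEmpty P T hS, hsplit]
    refine toOuterMeasure_bind_le_add
      (toOuterMeasure_iteration_lt_size_le hrange ht hγ hθ) fun R hR hshrink => ?_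
    rw [Set.mem_ofPred_eq, not_lt] at hshrink
    have hlt := size_lt_of_mem_support_iteration hN hS hR
    refine (ih (lt_of_le_of_lt ?_ hT)).trans ?_
    · rw [pow_succ, mul_assoc]
      exact mul_le_mul_of_nonneg_left hshrink (pow_nonneg (sub_nonneg.2 hθ) _)
    · rw [hq]
      gcongr
      exact Nat.le_sub_one_of_lt hlt

theorem toOuterMeasure_findBatch_not_allEmpty_le (hrange : Fintype.card V ^ 3 ≤ P.range)
    (ht : 1944 ≤ P.t) (hγ : 0 ≤ γ) (hN : 0 < N) {θ : ℝ} (hθ : θ ≤ 1) {T : ℕ}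
    (hT : (1 - θ) ^ T * Fintype.card V < 1) :
    (findBatch P H γ N k T).toOuterMeasure {R | ¬ AllEmpty k R} ≤
      Fintype.card V *
        (Fintype.card V * (2 * ENNReal.ofReal θ ^ N) + 4 * Fintype.card V * P.errorProb) := by
  refine toOuterMeasure_bind_le fun e _ => ?_
  have hsize := size_initialBuckets_le H e.2 ∅ k
  refine (toOuterMeasure_whileLoop_not_allEmpty_le hrange ht hγ hN hθ
    (lt_of_le_of_lt ?_ hT)).trans (by gcongr)
  exact mul_le_mul_of_nonneg_left (Nat.cast_le.2 hsize) (pow_nonneg (sub_nonneg.2 hθ) _)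

end FailureBounds

end OuterLoop

section Parameters

theorem exp_neg_pow_le_rpow {x b q : ℝ} (hx : 0 < x) {m : ℕ} (h : q * Real.log x ≤ b * m) :
    Real.exp (-b) ^ m ≤ x ^ (-q) := by
  rw [← Real.exp_nat_mul, Real.rpow_def_of_pos hx]
  exact Real.exp_le_exp.2 (by linarith)

theorem six_mul_sq_mul_rpow_le {x : ℝ} (hx : 2 ≤ x) (d : ℝ) :
    6 * x ^ 2 * x ^ (-(d + 5)) ≤ 1 / x ^ d := by
  have hpos : 0 < x := by linarith
  have hcube : (2 : ℝ) ^ 3 ≤ x ^ 3 := pow_le_pow_left₀ zero_le_two hx 3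
  have hsix : 6 * x ^ 2 ≤ x ^ 5 := by
    rw [show x ^ 5 = x ^ 3 * x ^ 2 by ring]
    gcongr
    linarith
  calc 6 * x ^ 2 * x ^ (-(d + 5)) ≤ x ^ 5 * x ^ (-(d + 5)) := by gcongr
    _ = 1 / x ^ d := by
      rw [← Real.rpow_natCast x 5, ← Real.rpow_add hpos, one_div, ← Real.rpow_neg hpos.le]
      congr 1
      push_cast
      ring

theorem natCast_mul_add_le_ofReal_one_div_rpow {n : ℕ} (hn : (2 : ℝ) ≤ n) {d : ℝ}
    {x y : ENNReal} (hx : x ≤ ENNReal.ofReal ((n : ℝ) ^ (-(d + 5))))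
    (hy : y ≤ ENNReal.ofReal ((n : ℝ) ^ (-(d + 5)))) :
    n * (n * (2 * x) + 4 * n * y) ≤ ENNReal.ofReal (1 / (n : ℝ) ^ d) := by
  refine le_trans ?_ (ENNReal.ofReal_le_ofReal (six_mul_sq_mul_rpow_le hn d))
  rw [ENNReal.ofReal_mul (by positivity), ENNReal.ofReal_mul (by positivity),
    ENNReal.ofReal_pow (by positivity), ENNReal.ofReal_natCast, ENNReal.ofReal_ofNat]
  set δ := ENNReal.ofReal ((n : ℝ) ^ (-(d + 5)))
  calc n * (n * (2 * x) + 4 * n * y) ≤ n * (n * (2 * δ) + 4 * n * δ) := by gcongr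
    _ = 6 * n ^ 2 * δ := by ring

theorem one_sub_pow_mul_lt_one {x θ : ℝ} (hx : 2 ≤ x) (hθ₀ : 0 < θ) (hθ₁ : θ ≤ 1) {T : ℕ}
    (hT : ⌊(1 / θ + 2) * Real.log x⌋₊ ≤ T) : (1 - θ) ^ T * x < 1 := by
  have hpos : 0 < x := by linarith
  have hlog : 1 < 2 * Real.log x := by
    linarith [Real.log_two_gt_d9, Real.log_le_log zero_lt_two hx]
  have hlt : (1 / θ + 2) * Real.log x < T + 1 :=
    (Nat.lt_floor_add_one _).trans_le (by gcongr)
  have hlog_lt : Real.log x < θ * T := by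
    have hmul := mul_lt_mul_of_pos_left hlt hθ₀
    rw [← mul_assoc, mul_add, mul_one_div_cancel hθ₀.ne'] at hmul
    linarith [mul_lt_mul_of_pos_left hlog hθ₀]
  calc (1 - θ) ^ T * x ≤ Real.exp (-θ) ^ T * x := by
        gcongr
        exact Real.one_sub_le_exp_neg θ
    _ = Real.exp (Real.log x - θ * T) := by
        rw [← Real.exp_nat_mul, sub_eq_neg_add, Real.exp_add, Real.exp_log hpos, mul_neg,
          mul_comm θ]
    _ < 1 := Real.exp_lt_one_iff.2 (by linarith)

end Parameters

theorem mainTheorem8_general {V : Type*} [Fintype V] [DecidableEq V] (P : EstimatorParams V)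
    (H : Dag V) {γ : ℝ} (hγ : 0 ≤ γ) {d a : ℝ} (hd : 0 ≤ d) (ha : 0 < a) {N k T : ℕ}
    (hV : 2 ≤ Fintype.card V) (ht : 1944 ≤ P.t) (hrange : Fintype.card V ^ 3 ≤ P.range)
    (hr : 32 * (d + 5) * Real.log (Fintype.card V) ≤ P.r)
    (hN : a * Real.log (Fintype.card V) ≤ N)
    (hT : ⌊(Real.exp ((d + 5) / a) + 2) * Real.log (Fintype.card V)⌋₊ ≤ T) :
    ENNReal.ofReal (1 - 1 / (Fintype.card V : ℝ) ^ d) ≤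
      (findBatch P H γ N k T).toOuterMeasure {S | AllEmpty k S} := by
  set n := Fintype.card V
  have hn : (2 : ℝ) ≤ n := by exact_mod_cast hV
  have : Nontrivial V := Fintype.one_lt_card_iff_nontrivial.1 hV
  set θ := Real.exp (-((d + 5) / a))
  have hθ₁ : θ ≤ 1 := Real.exp_le_one_iff.2 (neg_nonpos.2 (by positivity))
  have hN₀ : 0 < N := by
    exact_mod_cast (mul_pos ha (Real.log_pos (by linarith))).trans_le hN
  have hθN : ENNReal.ofReal θ ^ N ≤ ENNReal.ofReal ((n : ℝ) ^ (-(d + 5))) := by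
    rw [← ENNReal.ofReal_pow (Real.exp_nonneg _)]
    refine ENNReal.ofReal_le_ofReal (exp_neg_pow_le_rpow (by linarith) ?_)
    rw [div_mul_eq_mul_div, le_div_iff₀ ha]
    linarith [mul_le_mul_of_nonneg_left hN (by linarith : 0 ≤ d + 5)]
  have herr : P.errorProb ≤ ENNReal.ofReal ((n : ℝ) ^ (-(d + 5))) := by
    rw [EstimatorParams.errorProb, ← pow_one (Real.exp _)]
    exact ENNReal.ofReal_le_ofReal (exp_neg_pow_le_rpow (by linarith) (by push_cast; linarith))
  refine one_sub_le_toOuterMeasure_of_compl_le (by positivity) ?_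
  refine (toOuterMeasure_findBatch_not_allEmpty_le hrange ht hγ hN₀ hθ₁
    (one_sub_pow_mul_lt_one hn (Real.exp_pos _) hθ₁ ?_)).trans ?_
  · rwa [one_div, ← Real.exp_neg, neg_neg]
  exact natCast_mul_add_le_ofReal_one_div_rpow hn hθN herr

/-- `V` is the vertex set of the whole input graph, `n = |V|`, and `H` is a small subgraph. The
estimators have relative error `ε = 1/3`, so a sketch stores `t = c / ε ^ 2 = 9 * c` values from
`{1, …, n ^ 3}`; there are `⌈κ ln n⌉` hash functions; and a bucket is left after `N = ⌈a ln n⌉`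
consecutive stale vertices. -/
theorem mainTheorem8 :
    ∃ c₀ : ℕ, ∀ c : ℕ, c₀ ≤ c →
    ∀ d : ℝ, 1 ≤ d →
    ∃ κ₀ : ℝ, ∀ κ : ℝ, κ₀ ≤ κ →
    ∀ a : ℝ, 0 < a →
    ∃ C : ℝ, 0 < C ∧
      ∀ (V : Type*) [Fintype V] [DecidableEq V] (n : ℕ), n = Fintype.card V → 2 ≤ n →
      ∀ (ρ : ℕ), 1 < ρ →
      ∀ (H : Dag V), H.IsSmall ρ →
      ∀ (γ : ℝ), 0 < γ → γ < 1 / 2 →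
      ∀ (hashV : HashFamily V (n ^ 3)) (hashE : HashFamily (V × V) (n ^ 3)),
        ENNReal.ofReal (1 - 1 / (n : ℝ) ^ d) ≤
          (findBatch ⟨9 * c, ⌈κ * Real.log n⌉₊, n ^ 3, hashV, hashE⟩ H γ
              ⌈a * Real.log n⌉₊ (numBuckets ρ) ⌊C * Real.log n⌋₊).toOuterMeasure
            {S | AllEmpty (numBuckets ρ) S} := by
  refine ⟨216, fun c hc d hd => ⟨32 * (d + 5), fun κ hκ a ha =>
    ⟨Real.exp ((d + 5) / a) + 2, by positivity, ?_⟩⟩⟩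
  rintro V _ _ n rfl hn ρ _ H _ γ hγ _ hashV hashE
  exact mainTheorem8_general _ H hγ.le (by linarith) ha hn (by dsimp only; lia) le_rfl
    ((mul_le_mul_of_nonneg_right hκ (Real.log_natCast_nonneg _)).trans (Nat.le_ceil _))
    (Nat.le_ceil _) le_rfl
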